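/- Let $\Theta$ be a first-order signature (a set of individual constants, and sets of function and predicate symbols of arities $n\ge 1$), and let $\Theta_\approx$ be $\Theta$ with a new binary predicate symbol $\approx$. Formulas are built with $\wedge,\vee,\to,\neg,\circ,\forall,\exists$ and countably many variables; $For(\Theta_\approx)$ is the set of formulas over $\Theta_\approx$. **Calculus.** $\mathbf{QmbC}^{\approx}$ is the Hilbert calculus over $For(\Theta_\approx)$ with the axiom schemas (A1) $\alpha\to(\beta\to\alpha)$; (A2) $(\alpha\to(\beta\to\gamma))\to((\alpha\to\beta)\to(\alpha\to\gamma))$; (A3) $\alpha\to(\beta\to(\alpha\wedge\beta))$; (A4) $(\alpha\wedge\beta)\to\alpha$; (A5) $(\alpha\wedge\beta)\to\beta$; (A6) $\alpha\to(\alpha\vee\beta)$; (A7) $\beta\to(\alpha\vee\beta)$; (A8) $(\alpha\to\gamma)\to((\beta\to\gamma)\to((\alpha\vee\beta)\to\gamma))$; (A9) $\alpha\vee(\alpha\to\beta)$; (A10) $\alpha\vee\neg\alpha$; (A11) $\circ\alpha\to(\alpha\to(\neg\alpha\to\beta))$; (Ax12) $\varphi[x/t]\to\exists x\varphi$ and (Ax13)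 $\forall x\varphi\to\varphi[x/t]$, for $t$ free for $x$ in $\varphi$; (Ax14) $\alpha\to\beta$ whenever $\alpha$ is a variant of $\beta$ (obtained by adding or deleting void quantifiers and renaming bound variables); (AxEq1) $\forall x(x\approx x)$; (AxEq2) $(x\approx y)\to(\varphi\to\varphi[x\wr y])$, where $y$ is free for $x$ in $\varphi$ and $\varphi[x\wr y]$ is any formula obtained from $\varphi$ by replacing some (possibly none or all) free occurrences of $x$ by $y$; and the rules: modus ponens; from $\varphi\to\psi$ infer $\exists x\varphi\to\psi$ if $x$ is not free in $\psi$; from $\varphi\to\psi$ infer $\varphi\to\forall x\psi$ if $x$ is not free in $\varphi$. Write $\Gamma\vdash\varphi$ if $\varphi$ is derivable from $\Gamma$. **Semantics.** A swap structure $\mathcal B$ over a complete Boolean algebra $\mathcal A$ consists of a nonempty set $B\subseteq\{x\in A^3 : x_1\vee x_2=1,\ x_1\wedge x_2\wedge x_3=0\}$ and multioperations on $B$ with nonempty values such that $x\,\tilde\#\,y\subseteq\{z\in B: z_1=x_1\# y_1\}$ for $\#\in\{\wedge,\vee,\to\}$, $\tilde\neg x\subseteq\{z\in B: z_1=x_2\}$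 and $\tilde\circ x\subseteq\{z\in B: z_1=x_3\}$. Its designated set is $D=\{x\in B: x_1=1\}$. A structure $\mathfrak A$ over $\mathcal B$ has a nonempty domain $U$, interprets constants and function symbols on $U$ as usual, and interprets each $n$-ary predicate symbol $P$ by a function $P^{\mathfrak A}:U^n\to B$; it has *standard equality* if, for all $a,b\in U$, $\approx^{\mathfrak A}(a,b)\in D$ iff $a=b$. The diagram language adds a constant $\bar a$, denoting $a$, for each $a\in U$. For an assignment $\mu$ of elements of $U$ to the variables, $\hat\mu(\varphi)$ is the sentence obtained by replacing each free variable $x$ of $\varphi$ by $\overline{\mu(x)}$, and $\mu^x_a$ is $\mu$ changed to take the value $a$ at $x$. A $\mathbf{QmbC}^{\approx}$-valuation over $\mathfrak A$ is a function $v$ from the sentences of the diagram language to $B$ such that: (i) $v(P(t_1,\dots,t_n))=P^{\mathfrak A}(a_1,\dots,a_n)$, where $a_i$ is the value of the closed term $t_i$; (ii) $v(\#\varphi)\in\tilde\#\,v(\varphi)$ for $\#\in\{\neg,\circ\}$; (iii) $v(\varphi\#\psi)\in v(\varphi)\,\tilde\#\,v(\psi)$ for $\#\in\{\wedge,\vee,\to\}$;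 (iv) $v(\forall x\varphi)_1=\bigwedge_{a\in U}v(\varphi[x/\bar a])_1$; (v) $v(\exists x\varphi)_1=\bigvee_{a\in U}v(\varphi[x/\bar a])_1$; (vi) whenever $t$ is free for $z$ in $\varphi$ (and in $\psi$) and $b$ is the value of $t$ under $\mu$: if $v(\hat\mu(\varphi[z/t]))=v(\hat\mu(\varphi[z/\bar b]))$, then the same equality holds for $\neg\varphi$ and $\circ\varphi$ in place of $\varphi$; if it holds for $\varphi$ and for $\psi$, then it holds for $\varphi\#\psi$, $\#\in\{\wedge,\vee,\to\}$; and if $x\ne z$ does not occur in $t$ and $v(\widehat{\mu^x_a}(\varphi[z/t]))=v(\widehat{\mu^x_a}(\varphi[z/\bar b]))$ for all $a\in U$, then $v(\hat\mu((Qx\varphi)[z/t]))=v(\hat\mu((Qx\varphi)[z/\bar b]))$ for $Q\in\{\forall,\exists\}$; (vii) $v(\varphi)=v(\varphi')$ if $\varphi,\varphi'$ are variants of each other; (viii) $v(\hat\mu(\alpha))\in D$ for every instance $\alpha$ of (AxEq2) in the diagram language and every assignment $\mu$. For $\Gamma\cup\{\varphi\}\subseteq For(\Theta_\approx)$ write $\Gamma\models\varphi$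 if, for every swap structure over a complete Boolean algebra, every structure $\mathfrak A$ with standard equality over it and every $\mathbf{QmbC}^{\approx}$-valuation $v$ over $\mathfrak A$: if $v(\hat\mu(\gamma))\in D$ for all $\gamma\in\Gamma$ and all assignments $\mu$, then $v(\hat\mu(\varphi))\in D$ for all assignments $\mu$. **Theorem (soundness and completeness).** For every set $\Gamma\cup\{\varphi\}\subseteq For(\Theta_\approx)$: if $\Gamma\vdash\varphi$ then $\Gamma\models\varphi$; and if $\Gamma\models\varphi$ then $\Gamma\vdash\varphi$. -/

import Mathlib

universe u v w a

namespace QmbC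

/-! ## Syntax -/

/-- A first-order signature: individual constants, and function and predicate symbols, each with an
arity `n ≥ 1`. -/
structure Signature where
  Const : Type u
  Func : Type v
  Pred : Type v
  funcArity : Func → ℕ
  predArity : Pred → ℕ
  funcArity_pos : ∀ f, 0 < funcArity f
  predArity_pos : ∀ p, 0 < predArity p

/-- The signature `Θ_≈`: `Θ` with a new binary predicate symbol `none`, written `≈`. -/
@[reducible] def Signature.withEq (Θ : Signature.{u, v}) : Signature.{u, v} where
  Const := Θ.Const
  Func := Θ.Func
  Pred := Option Θ.Pred
  funcArity := Θ.funcArity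
  predArity := fun p => p.elim 2 Θ.predArity
  funcArity_pos := Θ.funcArity_pos
  predArity_pos := by
    intro p
    cases p with
    | none => exact Nat.zero_lt_two
    | some p => exact Θ.predArity_pos p

/-- The signature `Θ_U` of the diagram language: `Θ` with a new constant `Sum.inr a` (written `ā`)
for every `a ∈ U`. -/
@[reducible] def Signature.diagram (Θ : Signature.{u, v}) (U : Type w) :
    Signature.{max u w, v} where
  Const := Θ.Const ⊕ U
  Func := Θ.Func
  Pred := Θ.Pred
  funcArity := Θ.funcArity
  predArity := Θ.predArity
  funcArity_pos := Θ.funcArity_pos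
  predArity_pos := Θ.predArity_pos

/-- Terms; the individual variables are indexed by `ℕ`. -/
inductive Term (Θ : Signature.{u, v}) : Type (max u v)
  | var (x : ℕ) : Term Θ
  | const (c : Θ.Const) : Term Θ
  | func (f : Θ.Func) (ts : Fin (Θ.funcArity f) → Term Θ) : Term Θ

/-- The unary connectives `¬` and `∘`. -/
inductive UnConn
  | neg
  | circ

/-- The binary connectives `∧`, `∨`, `→`. -/
inductive BinConn
  | and
  | or
  | imp

/-- The quantifiers `∀` and `∃`. -/
inductive Quant
  | all
  | ex

/-- Formulas, with named bound variables. -/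
inductive Formula (Θ : Signature.{u, v}) : Type (max u v)
  | atom (p : Θ.Pred) (ts : Fin (Θ.predArity p) → Term Θ) : Formula Θ
  | un (c : UnConn) (φ : Formula Θ) : Formula Θ
  | bin (c : BinConn) (φ ψ : Formula Θ) : Formula Θ
  | quant (q : Quant) (x : ℕ) (φ : Formula Θ) : Formula Θ

section
variable {Θ : Signature.{u, v}}

namespace Term

/-- The variables occurring in a term. -/
def vars : Term Θ → Finset ℕ
  | var x => {x}
  | const _ => ∅
  | func _ ts => Finset.univ.biUnion fun i => (ts i).vars

/-- Simultaneous substitution of `σ x` for every variable `x`. -/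
def subst (σ : ℕ → Term Θ) : Term Θ → Term Θ
  | var x => σ x
  | const c => const c
  | func f ts => func f fun i => (ts i).subst σ

/-- `ReplSome x y t t'`: `t'` results from `t` by replacing some (maybe none, maybe all)
occurrences of the variable `x` by `y`. -/
inductive ReplSome (x y : ℕ) : Term Θ → Term Θ → Prop
  | refl (t : Term Θ) : ReplSome x y t t
  | var : ReplSome x y (var x) (var y)
  | func (f : Θ.Func) (ts ts' : Fin (Θ.funcArity f) → Term Θ) :
      (∀ i, ReplSome x y (ts i) (ts' i)) → ReplSome x y (func f ts) (func f ts')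

end Term

namespace Formula

abbrev neg (φ : Formula Θ) : Formula Θ := un .neg φ
abbrev circ (φ : Formula Θ) : Formula Θ := un .circ φ
abbrev and (φ ψ : Formula Θ) : Formula Θ := bin .and φ ψ
abbrev or (φ ψ : Formula Θ) : Formula Θ := bin .or φ ψ
abbrev imp (φ ψ : Formula Θ) : Formula Θ := bin .imp φ ψ
abbrev all (x : ℕ) (φ : Formula Θ) : Formula Θ := quant .all x φ
abbrev ex (x : ℕ) (φ : Formula Θ) : Formula Θ := quant .ex x φ

/-- The free variables of a formula. -/
def fv : Formula Θ → Finset ℕ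
  | atom _ ts => Finset.univ.biUnion fun i => (ts i).vars
  | un _ φ => φ.fv
  | bin _ φ ψ => φ.fv ∪ ψ.fv
  | quant _ x φ => φ.fv.erase x

/-- A sentence is a formula without free variables. -/
def IsSentence (φ : Formula Θ) : Prop := φ.fv = ∅

/-- Simultaneous replacement of the free occurrences of every variable `x` by `σ x`.
Bound variables are not renamed, so captures are possible. -/
def subst : (ℕ → Term Θ) → Formula Θ → Formula Θ
  | σ, atom p ts => atom p fun i => (ts i).subst σ
  | σ, un c φ => un c (φ.subst σ)
  | σ, bin c φ ψ => bin c (φ.subst σ) (ψ.subst σ)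
  | σ, quant q x φ => quant q x (φ.subst (Function.update σ x (Term.var x)))

/-- `φ[x/t]`: every free occurrence of `x` in `φ` is replaced by `t`. -/
def substVar (φ : Formula Θ) (x : ℕ) (t : Term Θ) : Formula Θ :=
  φ.subst (Function.update Term.var x t)

/-- `FreeFor t z φ`: the term `t` is free for the variable `z` in `φ`, that is, no free occurrence
of `z` in `φ` is in the scope of a quantifier that binds a variable of `t`. -/
def FreeFor (t : Term Θ) (z : ℕ) : Formula Θ → Prop
  | atom _ _ => True
  | un _ φ => FreeFor t z φ
  | bin _ φ ψ => FreeFor t z φ ∧ FreeFor t z ψ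
  | quant _ x φ => z ∉ φ.fv.erase x ∨ (x ∉ t.vars ∧ FreeFor t z φ)

/-- `Variant φ ψ`: `φ` is obtained from `ψ` by adding or deleting void quantifiers and renaming
bound variables, anywhere in the formula and any number of times. -/
inductive Variant : Formula Θ → Formula Θ → Prop
  | refl (φ : Formula Θ) : Variant φ φ
  | symm {φ ψ : Formula Θ} : Variant φ ψ → Variant ψ φ
  | trans {φ ψ χ : Formula Θ} : Variant φ ψ → Variant ψ χ → Variant φ χ
  | un (c : UnConn) {φ φ' : Formula Θ} : Variant φ φ' → Variant (un c φ) (un c φ')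
  | bin (c : BinConn) {φ φ' ψ ψ' : Formula Θ} :
      Variant φ φ' → Variant ψ ψ' → Variant (bin c φ ψ) (bin c φ' ψ')
  | quant (q : Quant) (x : ℕ) {φ φ' : Formula Θ} :
      Variant φ φ' → Variant (quant q x φ) (quant q x φ')
  | void (q : Quant) (x : ℕ) (φ : Formula Θ) : x ∉ φ.fv → Variant (quant q x φ) φ
  | rename (q : Quant) (x y : ℕ) (φ : Formula Θ) : y ∉ φ.fv → FreeFor (Term.var y) x φ →
      Variant (quant q x φ) (quant q y (φ.substVar x (Term.var y)))

/-- `ReplSome x y φ φ'`: `φ'` is one of the formulas `φ[x ≀ y]`, i.e. it results from `φ` by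
replacing some (maybe none, maybe all) free occurrences of the variable `x` by `y`. -/
inductive ReplSome (x y : ℕ) : Formula Θ → Formula Θ → Prop
  | refl (φ : Formula Θ) : ReplSome x y φ φ
  | atom (p : Θ.Pred) (ts ts' : Fin (Θ.predArity p) → Term Θ) :
      (∀ i, Term.ReplSome x y (ts i) (ts' i)) → ReplSome x y (atom p ts) (atom p ts')
  | un (c : UnConn) {φ φ' : Formula Θ} : ReplSome x y φ φ' → ReplSome x y (un c φ) (un c φ')
  | bin (c : BinConn) {φ φ' ψ ψ' : Formula Θ} :
      ReplSome x y φ φ' → ReplSome x y ψ ψ' → ReplSome x y (bin c φ ψ) (bin c φ' ψ')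
  | quant (q : Quant) (z : ℕ) {φ φ' : Formula Θ} : z ≠ x →
      ReplSome x y φ φ' → ReplSome x y (quant q z φ) (quant q z φ')

/-- The atomic formula `(s e t)`, for a binary predicate symbol `e`. -/
def binAtom (e : Θ.Pred) (he : Θ.predArity e = 2) (s t : Term Θ) : Formula Θ :=
  atom e fun i => ![s, t] (Fin.cast he i)

end Formula

/-! ## The Hilbert calculi -/

open Formula in
/-- The axioms of `QmbC`: those of the propositional logic `mbC` together with the axioms for the
quantifiers and for variants. -/
inductive QmbCAx : Formula Θ → Prop
  | a1 (α β : Formula Θ) : QmbCAx (α.imp (β.imp α))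
  | a2 (α β γ : Formula Θ) :
      QmbCAx ((α.imp (β.imp γ)).imp ((α.imp β).imp (α.imp γ)))
  | a3 (α β : Formula Θ) : QmbCAx (α.imp (β.imp (α.and β)))
  | a4 (α β : Formula Θ) : QmbCAx ((α.and β).imp α)
  | a5 (α β : Formula Θ) : QmbCAx ((α.and β).imp β)
  | a6 (α β : Formula Θ) : QmbCAx (α.imp (α.or β))
  | a7 (α β : Formula Θ) : QmbCAx (β.imp (α.or β))
  | a8 (α β γ : Formula Θ) :
      QmbCAx ((α.imp γ).imp ((β.imp γ).imp ((α.or β).imp γ)))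
  | a9 (α β : Formula Θ) : QmbCAx (α.or (α.imp β))
  | a10 (α : Formula Θ) : QmbCAx (α.or α.neg)
  | a11 (α β : Formula Θ) : QmbCAx (α.circ.imp (α.imp (α.neg.imp β)))
  | ax12 (φ : Formula Θ) (x : ℕ) (t : Term Θ) : FreeFor t x φ →
      QmbCAx ((φ.substVar x t).imp (ex x φ))
  | ax13 (φ : Formula Θ) (x : ℕ) (t : Term Θ) : FreeFor t x φ →
      QmbCAx ((all x φ).imp (φ.substVar x t))
  | ax14 (α β : Formula Θ) : Variant α β → QmbCAx (α.imp β)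

open Formula in
/-- The instances `(x e y) → (φ → φ[x ≀ y])` of the second axiom schema of equality, where `y` is
free for `x` in `φ`, for a binary predicate symbol `e`. -/
inductive AxEq2 (e : Θ.Pred) (he : Θ.predArity e = 2) : Formula Θ → Prop
  | intro (x y : ℕ) (φ φ' : Formula Θ) : FreeFor (Term.var y) x φ → Formula.ReplSome x y φ φ' →
      AxEq2 e he ((binAtom e he (Term.var x) (Term.var y)).imp (φ.imp φ'))

/-- The axioms of `QmbC^≈` over `Θ_≈`. -/
inductive QmbCEqAx : Formula Θ.withEq → Prop
  | qmbc {φ : Formula Θ.withEq} : QmbCAx φ → QmbCEqAx φ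
  | axEq1 (x : ℕ) :
      QmbCEqAx (Formula.all x (Formula.binAtom none rfl (Term.var x) (Term.var x)))
  | axEq2 {φ : Formula Θ.withEq} : AxEq2 none rfl φ → QmbCEqAx φ

/-- `Derives Ax Γ φ`: there is a derivation of `φ` from the premises `Γ` in the Hilbert calculus
with axioms `Ax` and the rules (MP), (∃-In) and (∀-In). -/
inductive Derives (Ax : Formula Θ → Prop) (Γ : Set (Formula Θ)) : Formula Θ → Prop
  | ax {φ : Formula Θ} : Ax φ → Derives Ax Γ φ
  | hyp {φ : Formula Θ} : φ ∈ Γ → Derives Ax Γ φ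
  | mp {φ ψ : Formula Θ} : Derives Ax Γ φ → Derives Ax Γ (φ.imp ψ) → Derives Ax Γ ψ
  | exIn {φ ψ : Formula Θ} (x : ℕ) : x ∉ ψ.fv →
      Derives Ax Γ (φ.imp ψ) → Derives Ax Γ ((Formula.ex x φ).imp ψ)
  | allIn {φ ψ : Formula Θ} (x : ℕ) : x ∉ φ.fv →
      Derives Ax Γ (φ.imp ψ) → Derives Ax Γ (φ.imp (Formula.all x ψ))

/-- `Γ ⊢ φ` in `QmbC^≈`. -/
def DerivesEq (Γ : Set (Formula Θ.withEq)) (φ : Formula Θ.withEq) : Prop :=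
  Derives QmbCEqAx Γ φ

/-! ## Swap structures and first-order structures over them -/

/-- The Boolean operation of a binary connective. -/
def BinConn.op {A : Type a} [BooleanAlgebra A] : BinConn → A → A → A
  | .and, p, q => p ⊓ q
  | .or, p, q => p ⊔ q
  | .imp, p, q => p ⇨ q

/-- The coordinate of a snapshot that a unary connective reads: the second for `¬`, the third
for `∘`. -/
def UnConn.proj {A : Type a} : UnConn → A × A × A → A
  | .neg, x => x.2.1
  | .circ, x => x.2.2

/-- The infimum (for `∀`) or the supremum (for `∃`) of a family in a complete Boolean algebra. -/
def Quant.op {A : Type a} [CompleteBooleanAlgebra A] {U : Type w} : Quant → (U → A) → A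
  | .all, f => ⨅ b, f b
  | .ex, f => ⨆ b, f b

/-- A swap structure for `mbC` over the Boolean algebra `A`: a multialgebra whose universe is a
nonempty set of snapshots and whose (nonempty-valued) multioperations respect the first
coordinates. -/
structure SwapStructure (A : Type a) [BooleanAlgebra A] where
  carrier : Set (A × A × A)
  carrier_nonempty : carrier.Nonempty
  sup_eq_top : ∀ x ∈ carrier, x.1 ⊔ x.2.1 = ⊤
  inf_eq_bot : ∀ x ∈ carrier, x.1 ⊓ x.2.1 ⊓ x.2.2 = ⊥
  un : UnConn → carrier → Set carrier
  bin : BinConn → carrier → carrier → Set carrier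
  un_nonempty : ∀ c x, (un c x).Nonempty
  bin_nonempty : ∀ c x y, (bin c x y).Nonempty
  un_fst : ∀ c x, ∀ z ∈ un c x, z.1.1 = c.proj x.1
  bin_fst : ∀ c x y, ∀ z ∈ bin c x y, z.1.1 = c.op x.1.1 y.1.1

/-- The designated elements of the Nmatrix of `B` are the snapshots with first coordinate `1`. -/
def SwapStructure.D {A : Type a} [BooleanAlgebra A] (B : SwapStructure A) : Set B.carrier :=
  {x | x.1.1 = ⊤}

/-- A first-order structure with domain `U` over the signature `Θ` and the Nmatrix of `B`. -/
structure Struc (Θ : Signature.{u, v}) (U : Type w) {A : Type a} [CompleteBooleanAlgebra A]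
    (B : SwapStructure A) where
  const : Θ.Const → U
  func : (f : Θ.Func) → (Fin (Θ.funcArity f) → U) → U
  pred : (p : Θ.Pred) → (Fin (Θ.predArity p) → U) → B.carrier

variable {U : Type w} {A : Type a} [CompleteBooleanAlgebra A] {B : SwapStructure A}

/-- The value of a term in a structure under the assignment `μ`. -/
def Struc.eval (S : Struc Θ U B) (μ : ℕ → U) : Term Θ → U
  | .var x => μ x
  | .const c => S.const c
  | .func f ts => S.func f fun i => S.eval μ (ts i)

/-- The extension of `S` to the diagram language, where `ā` denotes `a`. -/
def Struc.expand (S : Struc Θ U B) : Struc (Θ.diagram U) U B where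
  const := Sum.elim S.const id
  func := S.func
  pred := S.pred

/-- The closed term `ā` of the diagram language. -/
def name (b : U) : Term (Θ.diagram U) := Term.const (Sum.inr b)

/-- Terms over `Θ` as terms of the diagram language. -/
def Term.lift (U : Type w) : Term Θ → Term (Θ.diagram U)
  | .var x => .var x
  | .const c => .const (Sum.inl c)
  | .func f ts => .func f fun i => (ts i).lift U

/-- Formulas over `Θ` as formulas of the diagram language. -/
def Formula.lift (U : Type w) : Formula Θ → Formula (Θ.diagram U)
  | .atom p ts => .atom p fun i => (ts i).lift U
  | .un c φ => .un c (φ.lift U)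
  | .bin c φ ψ => .bin c (φ.lift U) (ψ.lift U)
  | .quant q x φ => .quant q x (φ.lift U)

/-- The sentence `μ̂(φ)`: every free variable `x` of `φ` is replaced by the constant naming
`μ x`. -/
def Formula.close (μ : ℕ → U) (φ : Formula (Θ.diagram U)) : Formula (Θ.diagram U) :=
  φ.subst fun x => name (μ x)

open Formula in
/-- `QmbC`-valuations over the structure `S`. They are functions on the sentences of the diagram
language; here they are total functions on its formulas, of which only the values at sentences are
constrained and used. -/
structure IsValuation (S : Struc Θ U B) (val : Formula (Θ.diagram U) → B.carrier) : Prop where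
  atom : ∀ p ts, (Formula.atom p ts).IsSentence → ∀ μ : ℕ → U,
    val (Formula.atom p ts) = S.pred p fun i => S.expand.eval μ (ts i)
  un : ∀ c φ, φ.IsSentence → val (Formula.un c φ) ∈ B.un c (val φ)
  bin : ∀ c φ ψ, φ.IsSentence → ψ.IsSentence →
    val (Formula.bin c φ ψ) ∈ B.bin c (val φ) (val ψ)
  quant : ∀ q x φ, (Formula.quant q x φ).IsSentence →
    (val (Formula.quant q x φ)).1.1 = Quant.op q fun b : U => (val (φ.substVar x (name b))).1.1
  subst_un : ∀ (c : UnConn) φ z t, FreeFor t z φ → ∀ μ : ℕ → U,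
    val (close μ (φ.substVar z t)) = val (close μ (φ.substVar z (name (S.expand.eval μ t)))) →
    val (close μ ((Formula.un c φ).substVar z t)) =
      val (close μ ((Formula.un c φ).substVar z (name (S.expand.eval μ t))))
  subst_bin : ∀ (c : BinConn) φ ψ z t, FreeFor t z φ → FreeFor t z ψ → ∀ μ : ℕ → U,
    val (close μ (φ.substVar z t)) = val (close μ (φ.substVar z (name (S.expand.eval μ t)))) →
    val (close μ (ψ.substVar z t)) = val (close μ (ψ.substVar z (name (S.expand.eval μ t)))) →
    val (close μ ((Formula.bin c φ ψ).substVar z t)) =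
      val (close μ ((Formula.bin c φ ψ).substVar z (name (S.expand.eval μ t))))
  subst_quant : ∀ (q : Quant) φ z t, FreeFor t z φ → ∀ (μ : ℕ → U) (x : ℕ),
    x ≠ z → x ∉ t.vars →
    (∀ b : U, val (close (Function.update μ x b) (φ.substVar z t)) =
      val (close (Function.update μ x b) (φ.substVar z (name (S.expand.eval μ t))))) →
    val (close μ ((Formula.quant q x φ).substVar z t)) =
      val (close μ ((Formula.quant q x φ).substVar z (name (S.expand.eval μ t))))
  variant : ∀ φ ψ, φ.IsSentence → ψ.IsSentence → Variant φ ψ → val φ = val ψ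

/-- A structure over `Θ_≈` with standard equality: `≈(b, c)` is designated iff `b = c`. -/
def HasStandardEq (S : Struc Θ.withEq U B) : Prop :=
  ∀ b c : U, S.pred none ![b, c] ∈ B.D ↔ b = c

/-- `QmbC^≈`-valuations: `QmbC`-valuations for which every instance of the second axiom schema of
equality in the diagram language is designated under every assignment. -/
structure IsValuationEq (S : Struc Θ.withEq U B)
    (val : Formula (Θ.withEq.diagram U) → B.carrier) : Prop extends IsValuation S val where
  axEq2 : ∀ (φ : Formula (Θ.withEq.diagram U)) (μ : ℕ → U),
    AxEq2 none rfl φ → val (φ.close μ) ∈ B.D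

end

/-- `Γ ⊨ φ` in `QmbC^≈`: semantical consequence over all first-order swap structures with standard
equality, with domains in `Type w` and complete Boolean algebras in `Type a`. -/
def EntailsEq {Θ : Signature.{u, v}} (Γ : Set (Formula Θ.withEq)) (φ : Formula Θ.withEq) : Prop :=
  ∀ (A : Type a) [CompleteBooleanAlgebra A] (B : SwapStructure A) (U : Type w) [Nonempty U]
    (S : Struc Θ.withEq U B), HasStandardEq S →
    ∀ val : Formula (Θ.withEq.diagram U) → B.carrier, IsValuationEq S val →
      (∀ γ ∈ Γ, ∀ μ : ℕ → U, val ((γ.lift U).close μ) ∈ B.D) →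
      ∀ μ : ℕ → U, val ((φ.lift U).close μ) ∈ B.D

end QmbC

/-! Soundness. The multioperations are nondeterministic, but they fix first coordinates: those of
compound formulas are computed from snapshot coordinates by the Boolean operations, infima and
suprema. Designation means that the first coordinate is `⊤`, so an implication is designated exactly
when an inequality holds between first coordinates, and the propositional axioms become Boolean
computations. (A10) and (A11) are the two conditions that define snapshots. For (Ax12) and (Ax13)
one needs a substitution lemma (`IsValuation.close_substVar`): it fails for arbitrary choices of
values and is what clause (vi) supplies, by induction on formulas.

Completeness is a Henkin argument with a two-element algebra. Generalizing over a free variable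
reduces it to a sentence `φ`. If `φ` is not derivable, add a witnessing constant for each universal
formula. The formulas `φ[x/c] → ∀x φ` are conservative (`LocalDerives.of_henkin`): in a finite
derivation, the witness of greatest depth occurs only in its own Henkin formula, and can be replaced
by a fresh variable (`Derives.of_witness`). Zorn's lemma then gives a theory `Δ` maximal among those
that do not yield `φ` (`exists_isHenkinTheory`). As `¬` is paraconsistent, it cannot express
refutation; the formula `φ` itself plays the role of falsum, and (A9) makes implication classical.

The model consists of closed terms modulo equality in `Δ`, so its equality is standard. The value of
`ψ` is the triple of truth values of `ψ ∈ Δ`, `¬ψ ∈ Δ`, `∘ψ ∈ Δ`. Congruence of equality in `Δ`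
(`IsHenkinTheory.eq_subst`) gives clause (vi) and (AxEq2).

Passing between languages (adding names, naming elements by representatives, removing Henkin
constants) is always a replacement of constants by terms, `Formula.kmap`. It preserves derivability
as soon as the new terms avoid finitely many variables (`Derives.kmap`). -/

namespace QmbC

/-! ## Substitution -/

namespace Term
variable {Θ : Signature.{u, v}}

theorem subst_congr {σ τ : ℕ → Term Θ} {t : Term Θ} (h : ∀ x ∈ t.vars, σ x = τ x) :
    t.subst σ = t.subst τ := by
  induction t with
  | var x => exact h x (by simp [vars])
  | const c => rfl
  | func f ts ih =>
    simp only [subst, func.injEq, heq_eq_eq, true_and]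
    funext i
    exact ih i fun x hx => h x (by simp only [vars, Finset.mem_biUnion]; exact ⟨i, by simp, hx⟩)

@[simp] theorem subst_var (t : Term Θ) : t.subst var = t := by
  induction t with
  | var x => rfl
  | const c => rfl
  | func f ts ih => simp only [subst, ih]

theorem subst_subst (t : Term Θ) (σ τ : ℕ → Term Θ) :
    (t.subst σ).subst τ = t.subst fun x => (σ x).subst τ := by
  induction t with
  | var x => rfl
  | const c => rfl
  | func f ts ih => simp only [subst, ih]

theorem mem_vars_func {y : ℕ} {f : Θ.Func} {ts : Fin (Θ.funcArity f) → Term Θ} :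
    y ∈ (func f ts).vars ↔ ∃ i, y ∈ (ts i).vars := by
  simp [vars]

theorem mem_vars_subst {y : ℕ} {σ : ℕ → Term Θ} {t : Term Θ} :
    y ∈ (t.subst σ).vars ↔ ∃ x ∈ t.vars, y ∈ (σ x).vars := by
  induction t with
  | var x => simp [subst, vars]
  | const c => simp [subst, vars]
  | func f ts ih =>
    simp only [subst, mem_vars_func, ih]
    constructor
    · rintro ⟨i, x, hx, hy⟩
      exact ⟨x, ⟨i, hx⟩, hy⟩
    · rintro ⟨x, ⟨i, hx⟩, hy⟩
      exact ⟨i, x, hx, hy⟩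

theorem subst_of_closed {t : Term Θ} (h : t.vars = ∅) (σ : ℕ → Term Θ) : t.subst σ = t := by
  conv_rhs => rw [← subst_var t]
  exact subst_congr (by simp [h])

theorem vars_subst_of_closed {σ : ℕ → Term Θ} (h : ∀ x, (σ x).vars = ∅) (t : Term Θ) :
    (t.subst σ).vars = ∅ := by
  ext y
  simp [mem_vars_subst, h]

end Term

/-- Every variable is kept or replaced by a closed term. -/
def Safe {Θ : Signature.{u, v}} (σ : ℕ → Term Θ) : Prop :=
  ∀ x, σ x = Term.var x ∨ (σ x).vars = ∅

theorem Safe.update_var {Θ : Signature.{u, v}} {σ : ℕ → Term Θ} (h : Safe σ) (x : ℕ) :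
    Safe (Function.update σ x (Term.var x)) := by
  intro y
  by_cases hy : y = x
  · subst hy; simp
  · simpa [hy] using h y

theorem safe_var {Θ : Signature.{u, v}} : Safe (Term.var : ℕ → Term Θ) := fun _ => .inl rfl

theorem safe_of_closed {Θ : Signature.{u, v}} {σ : ℕ → Term Θ} (h : ∀ x, (σ x).vars = ∅) :
    Safe σ := fun x => .inr (h x)

theorem Safe.mem_vars {Θ : Signature.{u, v}} {σ : ℕ → Term Θ} (h : Safe σ) {x y : ℕ}
    (hy : y ∈ (σ x).vars) : y = x := by
  rcases h x with h | h
  · simpa [h, Term.vars] using hy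
  · simp [h] at hy

namespace Formula
variable {Θ : Signature.{u, v}}

theorem mem_fv_atom {y : ℕ} {p : Θ.Pred} {ts : Fin (Θ.predArity p) → Term Θ} :
    y ∈ (atom p ts).fv ↔ ∃ i, y ∈ (ts i).vars := by
  simp [fv]

theorem subst_congr {φ : Formula Θ} {σ τ : ℕ → Term Θ} (h : ∀ x ∈ φ.fv, σ x = τ x) :
    φ.subst σ = φ.subst τ := by
  induction φ generalizing σ τ with
  | atom p ts =>
    simp only [subst, atom.injEq, heq_eq_eq, true_and]
    funext i
    exact Term.subst_congr fun x hx => h x (mem_fv_atom.2 ⟨i, hx⟩)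
  | un c φ ih => simp only [subst, ih (σ := σ) (τ := τ) h]
  | bin c φ ψ ih1 ih2 =>
    simp only [subst]
    rw [ih1 fun x hx => h x (by simp [fv, hx]), ih2 fun x hx => h x (by simp [fv, hx])]
  | quant q x φ ih =>
    simp only [subst]
    rw [ih]
    intro y hy
    by_cases hyx : y = x
    · subst hyx; simp
    · simpa [hyx] using h y (by simp [fv, hyx, hy])

@[simp] theorem subst_var (φ : Formula Θ) : φ.subst Term.var = φ := by
  induction φ with
  | atom p ts => simp only [subst, Term.subst_var]
  | un c φ ih => simp only [subst, ih]
  | bin c φ ψ ih1 ih2 => simp only [subst, ih1, ih2]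
  | quant q x φ ih => simp only [subst, Function.update_eq_self, ih]

theorem subst_eq_self {φ : Formula Θ} {σ : ℕ → Term Θ} (h : ∀ x ∈ φ.fv, σ x = Term.var x) :
    φ.subst σ = φ := by
  conv_rhs => rw [← subst_var φ]
  exact subst_congr h

theorem IsSentence.subst_eq {φ : Formula Θ} (h : φ.IsSentence) (σ : ℕ → Term Θ) :
    φ.subst σ = φ := by
  refine subst_eq_self fun x hx => ?_
  rw [IsSentence] at h
  simp [h] at hx

theorem substVar_of_notMem {φ : Formula Θ} {x : ℕ} (h : x ∉ φ.fv) (t : Term Θ) :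
    φ.substVar x t = φ := by
  refine subst_eq_self fun y hy => ?_
  have : y ≠ x := fun e => h (e ▸ hy)
  simp [this]

@[simp] theorem substVar_self (φ : Formula Θ) (x : ℕ) : φ.substVar x (Term.var x) = φ := by
  rw [substVar, Function.update_eq_self, subst_var]

theorem mem_fv_subst {φ : Formula Θ} {σ : ℕ → Term Θ} {y : ℕ} (h : y ∈ (φ.subst σ).fv) :
    ∃ x ∈ φ.fv, y ∈ (σ x).vars := by
  induction φ generalizing σ with
  | atom p ts =>
    obtain ⟨i, hi⟩ := mem_fv_atom.1 h
    obtain ⟨x, hx, hy⟩ := Term.mem_vars_subst.1 hi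
    exact ⟨x, mem_fv_atom.2 ⟨i, hx⟩, hy⟩
  | un c φ ih => exact ih h
  | bin c φ ψ ih1 ih2 =>
    simp only [subst, fv, Finset.mem_union] at h
    rcases h with h | h
    · obtain ⟨x, hx, hy⟩ := ih1 h
      exact ⟨x, by simp [fv, hx], hy⟩
    · obtain ⟨x, hx, hy⟩ := ih2 h
      exact ⟨x, by simp [fv, hx], hy⟩
  | quant q z φ ih =>
    simp only [subst, fv, Finset.mem_erase] at h
    obtain ⟨x, hx, hy⟩ := ih h.2
    by_cases hxz : x = z
    · subst hxz
      simp [Term.vars, h.1] at hy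
    · exact ⟨x, by simp [fv, hxz, hx], by simpa [hxz] using hy⟩

theorem Safe.notMem_fv_subst {φ : Formula Θ} {σ : ℕ → Term Θ} (hσ : Safe σ) {y : ℕ}
    (h : y ∉ φ.fv) : y ∉ (φ.subst σ).fv := by
  intro hy
  obtain ⟨x, hx, hxy⟩ := mem_fv_subst hy
  exact h (hσ.mem_vars hxy ▸ hx)

theorem isSentence_subst {σ : ℕ → Term Θ} (hσ : ∀ x, (σ x).vars = ∅) (φ : Formula Θ) :
    (φ.subst σ).IsSentence := by
  rw [IsSentence, Finset.eq_empty_iff_forall_notMem]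
  intro y hy
  obtain ⟨x, -, hx⟩ := mem_fv_subst hy
  simp [hσ] at hx

/-- No variable of a term `σ z` is captured when `σ` is applied to the formula. -/
def NoCapture : (ℕ → Term Θ) → Formula Θ → Prop
  | _, atom _ _ => True
  | σ, un _ φ => NoCapture σ φ
  | σ, bin _ φ ψ => NoCapture σ φ ∧ NoCapture σ ψ
  | σ, quant _ x φ => (∀ z ∈ φ.fv, z ≠ x → x ∉ (σ z).vars) ∧
      NoCapture (Function.update σ x (Term.var x)) φ

/-- If `σ` brought a variable under a binder of that same variable, the binder would shield it from
`τ`; this is the only obstruction to composing. -/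
theorem subst_subst {φ : Formula Θ} {σ : ℕ → Term Θ} (h : NoCapture σ φ) (τ : ℕ → Term Θ) :
    (φ.subst σ).subst τ = φ.subst fun x => (σ x).subst τ := by
  induction φ generalizing σ τ with
  | atom p ts => simp only [subst, Term.subst_subst]
  | un c φ ih => simp only [subst, ih h]
  | bin c φ ψ ih1 ih2 => simp only [subst, ih1 h.1, ih2 h.2]
  | quant q x φ ih =>
    simp only [subst, ih h.2, quant.injEq, true_and]
    refine subst_congr fun y hy => ?_
    by_cases hyx : y = x
    · subst hyx; simp [Term.subst]
    · simp only [ne_eq, hyx, not_false_eq_true, Function.update_of_ne]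
      refine Term.subst_congr fun z hz => ?_
      have : z ≠ x := fun e => h.1 y hy hyx (e ▸ hz)
      simp [this]

/-- The only variable that `σ z` can contain is `z` itself. Closing a formula by names is safe, and
safety survives the passage under a binder. -/
theorem Safe.noCapture {σ : ℕ → Term Θ} (hσ : Safe σ) (φ : Formula Θ) : NoCapture σ φ := by
  induction φ generalizing σ with
  | atom p ts => trivial
  | un c φ ih => exact ih hσ
  | bin c φ ψ ih1 ih2 => exact ⟨ih1 hσ, ih2 hσ⟩
  | quant q x φ ih => exact ⟨fun z _ hz hx => hz (hσ.mem_vars hx).symm, ih (hσ.update_var x)⟩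

theorem NoCapture.congr {φ : Formula Θ} {σ τ : ℕ → Term Θ} (h : NoCapture σ φ)
    (e : ∀ x ∈ φ.fv, σ x = τ x) : NoCapture τ φ := by
  induction φ generalizing σ τ with
  | atom p ts => trivial
  | un c φ ih => exact ih (σ := σ) h e
  | bin c φ ψ ih1 ih2 =>
    exact ⟨ih1 h.1 fun x hx => e x (by simp [fv, hx]), ih2 h.2 fun x hx => e x (by simp [fv, hx])⟩
  | quant q x φ ih =>
    refine ⟨fun z hz hzx => ?_, ih h.2 fun y hy => ?_⟩
    · rw [← e z (by simp [fv, hz, hzx])]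
      exact h.1 z hz hzx
    · by_cases hyx : y = x
      · subst hyx; simp
      · simpa [hyx] using e y (by simp [fv, hyx, hy])

theorem FreeFor.noCapture {t : Term Θ} {x : ℕ} {φ : Formula Θ} (h : FreeFor t x φ) :
    NoCapture (Function.update Term.var x t) φ := by
  induction φ with
  | atom p ts => trivial
  | un c φ ih => exact ih h
  | bin c φ ψ ih1 ih2 => exact ⟨ih1 h.1, ih2 h.2⟩
  | quant q z φ ih =>
    by_cases hx : x ∈ φ.fv.erase z
    · obtain ⟨hz, hf⟩ := h.resolve_left (not_not.2 hx)
      have hxz : x ≠ z := Finset.ne_of_mem_erase hx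
      refine ⟨fun y _ hyz => ?_, ?_⟩
      · by_cases hyx : y = x
        · subst hyx; simpa using hz
        · simpa [hyx, Term.vars] using hyz.symm
      · rw [Function.update_eq_self_iff.2]
        · exact ih hf
        · simp [hxz.symm]
    -- Here `x` is not free, so the substitution agrees with the identity on the free variables,
    -- whatever `t` is.
    · refine NoCapture.congr (φ := quant q z φ) (Safe.noCapture safe_var _) fun y hy => ?_
      have : y ≠ x := fun e => hx (e ▸ hy)
      simp [this]

/-- The variables that are quantified somewhere in a formula. -/
def bv : Formula Θ → Finset ℕ
  | atom _ _ => ∅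
  | un _ φ => φ.bv
  | bin _ φ ψ => φ.bv ∪ ψ.bv
  | quant _ x φ => insert x φ.bv

theorem freeFor_of_disjoint {t : Term Θ} {φ : Formula Θ} (h : ∀ y ∈ t.vars, y ∉ φ.bv) (x : ℕ) :
    FreeFor t x φ := by
  induction φ with
  | atom p ts => trivial
  | un c φ ih => exact ih h
  | bin c φ ψ ih1 ih2 =>
    exact ⟨ih1 fun y hy hb => h y hy (by simp [bv, hb]),
      ih2 fun y hy hb => h y hy (by simp [bv, hb])⟩
  | quant q z φ ih =>
    exact .inr ⟨fun hz => h z hz (by simp [bv]), ih fun y hy hb => h y hy (by simp [bv, hb])⟩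

theorem freeFor_of_closed {t : Term Θ} (ht : t.vars = ∅) (x : ℕ) (φ : Formula Θ) :
    FreeFor t x φ := freeFor_of_disjoint (by simp [ht]) x

theorem freeFor_self (x : ℕ) (φ : Formula Θ) : FreeFor (Term.var x) x φ := by
  induction φ with
  | atom p ts => trivial
  | un c φ ih => exact ih
  | bin c φ ψ ih1 ih2 => exact ⟨ih1, ih2⟩
  | quant q z φ ih =>
    by_cases h : x = z
    · subst h; exact .inl (by simp)
    · exact .inr ⟨by simpa [Term.vars] using Ne.symm h, ih⟩

theorem FreeFor.subst {t : Term Θ} {x : ℕ} {φ : Formula Θ} (h : FreeFor t x φ) {σ : ℕ → Term Θ}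
    (hσ : Safe σ) : FreeFor t x (φ.subst σ) := by
  induction φ generalizing σ with
  | atom p ts => trivial
  | un c φ ih => exact ih h hσ
  | bin c φ ψ ih1 ih2 => exact ⟨ih1 h.1 hσ, ih2 h.2 hσ⟩
  | quant q z φ ih =>
    rcases h with h | h
    · exact .inl (Safe.notMem_fv_subst (φ := quant q z φ) hσ h)
    · exact .inr ⟨h.1, ih h.2 (hσ.update_var z)⟩

/-- Valuations identify variants only among sentences; this lets variants with free variables be
closed. -/
theorem Variant.subst {φ ψ : Formula Θ} (h : Variant φ ψ) {σ : ℕ → Term Θ} (hσ : Safe σ) :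
    Variant (φ.subst σ) (ψ.subst σ) := by
  induction h generalizing σ with
  | refl φ => exact .refl _
  | symm _ ih => exact .symm (ih hσ)
  | trans _ _ ih1 ih2 => exact .trans (ih1 hσ) (ih2 hσ)
  | un c _ ih => exact .un c (ih hσ)
  | bin c _ _ ih1 ih2 => exact .bin c (ih1 hσ) (ih2 hσ)
  | quant q x _ ih => exact .quant q x (ih (hσ.update_var x))
  | void q x φ hx =>
    have e : φ.subst (Function.update σ x (Term.var x)) = φ.subst σ := subst_congr fun y hy => by
      have : y ≠ x := fun e => hx (e ▸ hy)
      simp [this]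
    rw [Formula.subst, e]
    exact .void q x _ (Safe.notMem_fv_subst hσ hx)
  | rename q x y φ hy hf =>
    have h := Variant.rename q x y (φ.subst (Function.update σ x (Term.var x)))
      (Safe.notMem_fv_subst (hσ.update_var x) hy) (hf.subst (hσ.update_var x))
    -- Both sides send `x` to `y` and every other free variable `z` of `φ` to `σ z`: on the right
    -- because `z ≠ y`, on the left because `σ z` is `z` or closed.
    suffices e : (φ.subst (Function.update σ x (Term.var x))).substVar x (Term.var y) =
        (φ.substVar x (Term.var y)).subst (Function.update σ y (Term.var y)) by
      rw [e] at h
      exact h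
    unfold Formula.substVar
    rw [subst_subst hf.noCapture, subst_subst (Safe.noCapture (hσ.update_var x) φ)]
    refine subst_congr fun z hz => ?_
    have hzy : z ≠ y := fun e => hy (e ▸ hz)
    by_cases hzx : z = x
    · subst hzx; simp [Term.subst]
    · simp only [ne_eq, hzx, not_false_eq_true, Function.update_of_ne, Term.subst, hzy]
      rcases hσ z with h | h
      · simp [h, Term.subst, hzx]
      · rw [Term.subst_of_closed h]

theorem termReplSome_subst (x y : ℕ) (t : Term Θ) :
    Term.ReplSome x y t (t.subst (Function.update Term.var x (Term.var y))) := by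
  induction t with
  | var z =>
    by_cases h : z = x
    · subst h; simpa [Term.subst] using Term.ReplSome.var
    · simpa [Term.subst, h] using Term.ReplSome.refl _
  | const c => exact .refl _
  | func f ts ih => exact .func f _ _ ih

theorem replSome_substVar (x y : ℕ) (φ : Formula Θ) :
    ReplSome x y φ (φ.substVar x (Term.var y)) := by
  induction φ with
  | atom p ts => exact .atom p _ _ fun i => termReplSome_subst x y (ts i)
  | un c φ ih => exact .un c ih
  | bin c φ ψ ih1 ih2 => exact .bin c ih1 ih2
  | quant q z φ ih =>
    by_cases h : z = x
    · subst h
      rw [substVar_of_notMem (by simp [fv])]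
      exact .refl _
    · have : (quant q z φ).substVar x (Term.var y) = quant q z (φ.substVar x (Term.var y)) := by
        rw [substVar, Formula.subst, Function.update_eq_self_iff.2 (by simp [h])]
        rfl
      rw [this]
      exact .quant q z h ih

theorem binAtom_subst (e : Θ.Pred) (he : Θ.predArity e = 2) (s t : Term Θ) (σ : ℕ → Term Θ) :
    (binAtom e he s t).subst σ = binAtom e he (s.subst σ) (t.subst σ) := by
  simp only [binAtom, subst, atom.injEq, heq_eq_eq, true_and]
  funext i
  generalize Fin.cast he i = j
  fin_cases j <;> rfl

end Formula
end QmbC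

namespace QmbC

/-! ## Replacement of constants by terms -/

/-- The signature `Θ` with its set of individual constants replaced by `C`. -/
@[reducible] def Signature.setConst (Θ : Signature.{u, v}) (C : Type w) : Signature.{w, v} where
  Const := C
  Func := Θ.Func
  Pred := Θ.Pred
  funcArity := Θ.funcArity
  predArity := Θ.predArity
  funcArity_pos := Θ.funcArity_pos
  predArity_pos := Θ.predArity_pos

section
variable {Θ : Signature.{u, v}} {C : Type w} {C' : Type a}

/-- Replacement of every constant `c` by the term `k c`. -/
def Term.kmap (k : C → Term (Θ.setConst C')) : Term (Θ.setConst C) → Term (Θ.setConst C')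
  | .var x => .var x
  | .const c => k c
  | .func f ts => .func f fun i => (ts i).kmap k

/-- Replacement of every constant `c` by the term `k c`; captures are possible. -/
def Formula.kmap (k : C → Term (Θ.setConst C')) :
    Formula (Θ.setConst C) → Formula (Θ.setConst C')
  | .atom p ts => .atom p fun i => (ts i).kmap k
  | .un c φ => .un c (φ.kmap k)
  | .bin c φ ψ => .bin c (φ.kmap k) (ψ.kmap k)
  | .quant q x φ => .quant q x (φ.kmap k)

/-- No variable of a term `k c` belongs to `F`. -/
def Avoids (k : C → Term (Θ.setConst C')) (F : Finset ℕ) : Prop :=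
  ∀ c, ∀ y ∈ (k c).vars, y ∉ F

theorem Avoids.mono {k : C → Term (Θ.setConst C')} {F G : Finset ℕ} (h : Avoids k G)
    (hFG : F ⊆ G) : Avoids k F := fun c y hy hF => h c y hy (hFG hF)

theorem Avoids.left {k : C → Term (Θ.setConst C')} {F G : Finset ℕ} (h : Avoids k (F ∪ G)) :
    Avoids k F := h.mono Finset.subset_union_left

theorem Avoids.right {k : C → Term (Θ.setConst C')} {F G : Finset ℕ} (h : Avoids k (F ∪ G)) :
    Avoids k G := h.mono Finset.subset_union_right

theorem avoids_of_closed {k : C → Term (Θ.setConst C')} (h : ∀ c, (k c).vars = ∅)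
    (F : Finset ℕ) : Avoids k F := fun c y hy => by simp [h] at hy

namespace Term
variable {k : C → Term (Θ.setConst C')}

theorem mem_vars_kmap {t : Term (Θ.setConst C)} {y : ℕ} (h : y ∈ (t.kmap k).vars) :
    y ∈ t.vars ∨ ∃ c, y ∈ (k c).vars := by
  induction t with
  | var x => exact .inl h
  | const c => exact .inr ⟨c, h⟩
  | func f ts ih =>
    obtain ⟨i, hi⟩ := mem_vars_func.1 h
    rcases ih i hi with h | h
    · exact .inl (mem_vars_func.2 ⟨i, h⟩)
    · exact .inr h

theorem kmap_subst {t : Term (Θ.setConst C)} {σ : ℕ → Term (Θ.setConst C)}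
    (h : ∀ c, ∀ y ∈ (k c).vars, σ y = var y) :
    (t.subst σ).kmap k = (t.kmap k).subst fun x => (σ x).kmap k := by
  induction t with
  | var x => rfl
  | const c =>
    change k c = (k c).subst _
    conv_lhs => rw [← subst_var (k c)]
    refine subst_congr fun y hy => ?_
    rw [h c y hy]
    rfl
  | func f ts ih =>
    change func (Θ := Θ.setConst C') f _ = func (Θ := Θ.setConst C') f _
    congr 1
    funext i
    exact ih i

theorem ReplSome.kmap {x y : ℕ} {t t' : Term (Θ.setConst C)} (h : ReplSome x y t t') :
    ReplSome x y (t.kmap k) (t'.kmap k) := by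
  induction h with
  | refl t => exact .refl _
  | var => exact .var
  | func f ts ts' _ ih => exact .func (Θ := Θ.setConst C') f _ _ ih

end Term

namespace Formula
variable {k : C → Term (Θ.setConst C')}

theorem mem_fv_kmap {φ : Formula (Θ.setConst C)} {y : ℕ} (h : y ∈ (φ.kmap k).fv) :
    y ∈ φ.fv ∨ ∃ c, y ∈ (k c).vars := by
  induction φ with
  | atom p ts =>
    obtain ⟨i, hi⟩ := mem_fv_atom.1 h
    rcases Term.mem_vars_kmap hi with h | h
    · exact .inl (mem_fv_atom.2 ⟨i, h⟩)
    · exact .inr h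
  | un c φ ih => exact ih h
  | bin c φ ψ ih1 ih2 =>
    rcases Finset.mem_union.1 h with h | h
    · exact (ih1 h).imp_left fun h => by simp [fv, h]
    · exact (ih2 h).imp_left fun h => by simp [fv, h]
  | quant q x φ ih =>
    obtain ⟨hx, h⟩ := Finset.mem_erase.1 h
    exact (ih h).imp_left fun h => by simp [fv, h, hx]

theorem notMem_fv_kmap {φ : Formula (Θ.setConst C)} {y : ℕ} (hk : Avoids k {y}) (h : y ∉ φ.fv) :
    y ∉ (φ.kmap k).fv := by
  intro hy
  rcases mem_fv_kmap hy with h' | ⟨c, h'⟩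
  · exact h h'
  · exact hk c y h' (by simp)

theorem isSentence_kmap (hk : ∀ c, (k c).vars = ∅) {φ : Formula (Θ.setConst C)}
    (h : φ.IsSentence) : (φ.kmap k).IsSentence := by
  rw [IsSentence, Finset.eq_empty_iff_forall_notMem] at h ⊢
  exact fun y => notMem_fv_kmap (avoids_of_closed hk _) (h y)

/-- On the right the substitution also acts on the variables just brought in by `k`, so `σ` has to
fix them. -/
theorem kmap_subst {φ : Formula (Θ.setConst C)} {σ : ℕ → Term (Θ.setConst C)}
    (h : ∀ c, ∀ y ∈ (k c).vars, σ y = Term.var y) :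
    (φ.subst σ).kmap k = (φ.kmap k).subst fun x => (σ x).kmap k := by
  induction φ generalizing σ with
  | atom p ts =>
    change atom (Θ := Θ.setConst C') p _ = atom (Θ := Θ.setConst C') p _
    congr 1
    funext i
    exact Term.kmap_subst h
  | un c φ ih => exact congrArg (un c) (ih h)
  | bin c φ ψ ih1 ih2 => exact congrArg₂ (bin c) (ih1 h) (ih2 h)
  | quant q x φ ih =>
    refine congrArg (quant q x) ((ih fun c y hy => ?_).trans ?_)
    · by_cases hyx : y = x
      · subst hyx; simp
      · simpa [hyx] using h c y hy
    · congr 1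
      funext z
      by_cases hz : z = x
      · subst hz; simp [Term.kmap]
      · simp [hz]

theorem kmap_substVar {φ : Formula (Θ.setConst C)} {x : ℕ} {t : Term (Θ.setConst C)}
    (hk : Avoids k {x}) : (φ.substVar x t).kmap k = (φ.kmap k).substVar x (t.kmap k) := by
  refine (kmap_subst fun c y hy => ?_).trans ?_
  · have : y ≠ x := fun e => hk c y hy (by simp [e])
    simp [this]
  · unfold substVar
    congr 1
    funext z
    by_cases hz : z = x
    · subst hz; simp
    · simp [hz, Term.kmap]

theorem FreeFor.kmap {φ : Formula (Θ.setConst C)} {x : ℕ} {t : Term (Θ.setConst C)}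
    (hk : Avoids k (insert x φ.bv)) (h : FreeFor t x φ) : FreeFor (t.kmap k) x (φ.kmap k) := by
  induction φ with
  | atom p ts => trivial
  | un c φ ih => exact ih hk h
  | bin c φ ψ ih1 ih2 =>
    exact ⟨ih1 (hk.mono (by simp only [bv]; grind)) h.1,
      ih2 (hk.mono (by simp only [bv]; grind)) h.2⟩
  | quant q z φ ih =>
    rcases h with h | ⟨hz, h⟩
    · exact .inl (notMem_fv_kmap (φ := quant q z φ) (hk.mono (by simp)) h)
    · refine .inr ⟨fun hz' => ?_, ih (hk.mono (by simp only [bv]; grind)) h⟩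
      rcases Term.mem_vars_kmap hz' with h' | ⟨c, h'⟩
      · exact hz h'
      · exact hk c z h' (by simp [bv])

theorem ReplSome.kmap {x y : ℕ} {φ φ' : Formula (Θ.setConst C)} (h : ReplSome x y φ φ') :
    ReplSome x y (φ.kmap k) (φ'.kmap k) := by
  induction h with
  | refl t => exact .refl _
  | atom p ts ts' h => exact .atom (Θ := Θ.setConst C') p _ _ fun i => (h i).kmap
  | un c _ ih => exact .un c ih
  | bin c _ _ ih1 ih2 => exact .bin c ih1 ih2
  | quant q z hz _ ih => exact .quant q z hz ih

/-- The finite set `F` depends on the chain of variant steps: the intermediate formulas may bind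
variables that are visible in neither end. -/
theorem Variant.kmap {φ ψ : Formula (Θ.setConst C)} (h : Variant φ ψ) :
    ∃ F : Finset ℕ, ∀ k : C → Term (Θ.setConst C'), Avoids k F →
      Variant (φ.kmap k) (ψ.kmap k) := by
  induction h with
  | refl φ => exact ⟨∅, fun k _ => .refl _⟩
  | symm _ ih =>
    obtain ⟨F, h⟩ := ih
    exact ⟨F, fun k hk => (h k hk).symm⟩
  | trans _ _ ih1 ih2 =>
    obtain ⟨F, h⟩ := ih1
    obtain ⟨G, h'⟩ := ih2
    exact ⟨F ∪ G, fun k hk => (h k hk.left).trans (h' k hk.right)⟩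
  | un c _ ih =>
    obtain ⟨F, h⟩ := ih
    exact ⟨F, fun k hk => (h k hk).un c⟩
  | bin c _ _ ih1 ih2 =>
    obtain ⟨F, h⟩ := ih1
    obtain ⟨G, h'⟩ := ih2
    exact ⟨F ∪ G, fun k hk => (h k hk.left).bin c (h' k hk.right)⟩
  | quant q x _ ih =>
    obtain ⟨F, h⟩ := ih
    exact ⟨F, fun k hk => (h k hk).quant q x⟩
  | void q x φ hx => exact ⟨{x}, fun k hk => .void q x _ (notMem_fv_kmap hk hx)⟩
  | rename q x y φ hy hf =>
    refine ⟨{y} ∪ insert x φ.bv, fun k hk => ?_⟩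
    have h := Variant.rename q x y (φ.kmap k) (notMem_fv_kmap hk.left hy) (hf.kmap hk.right)
    have e := kmap_substVar (φ := φ) (t := Term.var y) (hk.right.mono (F := {x}) (by simp))
    exact cast (congrArg (fun χ => Variant _ (Formula.quant q y χ)) e.symm) h

theorem kmap_binAtom {e : Θ.Pred} {he : Θ.predArity e = 2} {s t : Term (Θ.setConst C)} :
    (binAtom (Θ := Θ.setConst C) e he s t).kmap k =
      binAtom (Θ := Θ.setConst C') e he (s.kmap k) (t.kmap k) := by
  change atom (Θ := Θ.setConst C') e _ = atom (Θ := Θ.setConst C') e _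
  congr 1
  funext i
  change Term.kmap k (![s, t] (Fin.cast he i)) = ![s.kmap k, t.kmap k] (Fin.cast he i)
  generalize Fin.cast he i = j
  fin_cases j <;> rfl

end Formula

theorem AxEq2.kmap {e : Θ.Pred} {he : Θ.predArity e = 2} {φ : Formula (Θ.setConst C)}
    (h : AxEq2 (Θ := Θ.setConst C) e he φ) : ∃ F : Finset ℕ, ∀ k : C → Term (Θ.setConst C'),
      Avoids k F → AxEq2 (Θ := Θ.setConst C') e he (φ.kmap k) := by
  obtain ⟨x, y, φ, φ', hf, hr⟩ := h
  refine ⟨insert x φ.bv, fun k hk => ?_⟩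
  have h := AxEq2.intro (Θ := Θ.setConst C') (e := e) (he := he) x y _ _ (hf.kmap hk) (hr.kmap)
  exact cast (congrArg (fun χ => AxEq2 (Θ := Θ.setConst C') e he (.bin .imp χ _))
    Formula.kmap_binAtom.symm) h

open Formula in
theorem QmbCAx.kmap {φ : Formula (Θ.setConst C)} (h : QmbCAx φ) :
    ∃ F : Finset ℕ, ∀ k : C → Term (Θ.setConst C'), Avoids k F → QmbCAx (φ.kmap k) := by
  cases h with
  | a1 α β => exact ⟨∅, fun k _ => .a1 _ _⟩
  | a2 α β γ => exact ⟨∅, fun k _ => .a2 _ _ _⟩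
  | a3 α β => exact ⟨∅, fun k _ => .a3 _ _⟩
  | a4 α β => exact ⟨∅, fun k _ => .a4 _ _⟩
  | a5 α β => exact ⟨∅, fun k _ => .a5 _ _⟩
  | a6 α β => exact ⟨∅, fun k _ => .a6 _ _⟩
  | a7 α β => exact ⟨∅, fun k _ => .a7 _ _⟩
  | a8 α β γ => exact ⟨∅, fun k _ => .a8 _ _ _⟩
  | a9 α β => exact ⟨∅, fun k _ => .a9 _ _⟩
  | a10 α => exact ⟨∅, fun k _ => .a10 _⟩
  | a11 α β => exact ⟨∅, fun k _ => .a11 _ _⟩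
  | ax12 φ x t hf =>
    refine ⟨insert x φ.bv, fun k hk => ?_⟩
    have e := kmap_substVar (φ := φ) (t := t) (hk.mono (F := {x}) (by simp))
    exact cast (congrArg (fun χ => QmbCAx (.bin .imp χ _)) e.symm)
      (QmbCAx.ax12 (φ.kmap k) x (t.kmap k) (hf.kmap hk))
  | ax13 φ x t hf =>
    refine ⟨insert x φ.bv, fun k hk => ?_⟩
    have e := kmap_substVar (φ := φ) (t := t) (hk.mono (F := {x}) (by simp))
    exact cast (congrArg (fun χ => QmbCAx (.bin .imp _ χ)) e.symm)
      (QmbCAx.ax13 (φ.kmap k) x (t.kmap k) (hf.kmap hk))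
  | ax14 α β hv =>
    obtain ⟨F, h⟩ := hv.kmap (C' := C')
    exact ⟨F, fun k hk => .ax14 _ _ (h k hk)⟩

end

/-- The axioms of `QmbC^≈` over a signature with a designated binary predicate symbol `e`. -/
inductive EqAx {Θ : Signature.{u, v}} (e : Θ.Pred) (he : Θ.predArity e = 2) : Formula Θ → Prop
  | qmbc {φ : Formula Θ} : QmbCAx φ → EqAx e he φ
  | axEq1 (x : ℕ) : EqAx e he (.all x (.binAtom e he (.var x) (.var x)))
  | axEq2 {φ : Formula Θ} : AxEq2 e he φ → EqAx e he φ

theorem Derives.mono {Θ : Signature.{u, v}} {Ax Ax' : Formula Θ → Prop} {Γ Γ' : Set (Formula Θ)}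
    (hA : ∀ φ, Ax φ → Ax' φ) (hΓ : Γ ⊆ Γ') {φ : Formula Θ} (h : Derives Ax Γ φ) :
    Derives Ax' Γ' φ := by
  induction h with
  | ax h => exact .ax (hA _ h)
  | hyp h => exact .hyp (hΓ h)
  | mp _ _ ih1 ih2 => exact .mp ih1 ih2
  | exIn x hx _ ih => exact .exIn x hx ih
  | allIn x hx _ ih => exact .allIn x hx ih

/-- `EqAx` is stated for any binary symbol `e`, so that the same calculus is available in the
diagram languages. -/
theorem derivesEq_iff {Θ : Signature.{u, v}} {Γ : Set (Formula Θ.withEq)} {φ : Formula Θ.withEq} :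
    DerivesEq Γ φ ↔ Derives (EqAx (Θ := Θ.withEq) none rfl) Γ φ := by
  constructor
  · refine Derives.mono (fun φ h => ?_) subset_rfl
    cases h with
    | qmbc h => exact .qmbc h
    | axEq1 x => exact .axEq1 x
    | axEq2 h => exact .axEq2 h
  · refine Derives.mono (fun φ h => ?_) subset_rfl
    cases h with
    | qmbc h => exact .qmbc h
    | axEq1 x => exact .axEq1 x
    | axEq2 h => exact .axEq2 h

/-! ### Derivations under replacement of constants -/

section
variable {Θ : Signature.{u, v}} {C : Type w} {C' : Type a}

theorem EqAx.kmap {e : Θ.Pred} {he : Θ.predArity e = 2} {φ : Formula (Θ.setConst C)}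
    (h : EqAx (Θ := Θ.setConst C) e he φ) : ∃ F : Finset ℕ, ∀ k : C → Term (Θ.setConst C'),
      Avoids k F → EqAx (Θ := Θ.setConst C') e he (φ.kmap k) := by
  cases h with
  | qmbc h =>
    obtain ⟨F, h⟩ := h.kmap (C' := C')
    exact ⟨F, fun k hk => .qmbc (h k hk)⟩
  | axEq1 x =>
    exact ⟨∅, fun k _ => cast (congrArg (fun χ => EqAx (Θ := Θ.setConst C') e he (.quant .all x χ))
      Formula.kmap_binAtom.symm) (EqAx.axEq1 x)⟩
  | axEq2 h =>
    obtain ⟨F, h⟩ := h.kmap (C' := C')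
    exact ⟨F, fun k hk => .axEq2 (h k hk)⟩

/-- A derivation is finite, so only finitely many variables occur in its side conditions. Terms that
avoid them disturb no axiom and no rule. -/
theorem Derives.kmap {e : Θ.Pred} {he : Θ.predArity e = 2} {Γ : Set (Formula (Θ.setConst C))}
    {φ : Formula (Θ.setConst C)} (h : Derives (EqAx (Θ := Θ.setConst C) e he) Γ φ) :
    ∃ F : Finset ℕ, ∀ k : C → Term (Θ.setConst C'), Avoids k F →
      Derives (EqAx (Θ := Θ.setConst C') e he) (Formula.kmap k '' Γ) (φ.kmap k) := by
  induction h with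
  | ax h =>
    obtain ⟨F, h⟩ := h.kmap (C' := C')
    exact ⟨F, fun k hk => .ax (h k hk)⟩
  | hyp h => exact ⟨∅, fun k _ => .hyp ⟨_, h, rfl⟩⟩
  | mp _ _ ih1 ih2 =>
    obtain ⟨F, h⟩ := ih1
    obtain ⟨G, h'⟩ := ih2
    exact ⟨F ∪ G, fun k hk => .mp (h k hk.left) (h' k hk.right)⟩
  | exIn x hx _ ih =>
    obtain ⟨F, h⟩ := ih
    exact ⟨F ∪ {x}, fun k hk => .exIn x (Formula.notMem_fv_kmap hk.right hx) (h k hk.left)⟩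
  | allIn x hx _ ih =>
    obtain ⟨F, h⟩ := ih
    exact ⟨F ∪ {x}, fun k hk => .allIn x (Formula.notMem_fv_kmap hk.right hx) (h k hk.left)⟩

end

/-! ## Formulas in the diagram language -/

section
variable {Θ : Signature.{u, v}} {U : Type w}

theorem Term.lift_eq_kmap (t : Term Θ) : t.lift U =
    Term.kmap (Θ := Θ) (C := Θ.Const) (C' := Θ.Const ⊕ U) (fun c => .const (.inl c)) t := by
  induction t with
  | var x => rfl
  | const c => rfl
  | func f ts ih => exact congrArg (Term.func (Θ := Θ.diagram U) f) (funext ih)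

theorem Formula.lift_eq_kmap (φ : Formula Θ) : φ.lift U =
    Formula.kmap (Θ := Θ) (C := Θ.Const) (C' := Θ.Const ⊕ U) (fun c => .const (.inl c)) φ := by
  induction φ with
  | atom p ts =>
    exact congrArg (Formula.atom (Θ := Θ.diagram U) p) (funext fun i => Term.lift_eq_kmap (ts i))
  | un c φ ih => exact congrArg (Formula.un c) ih
  | bin c φ ψ ih1 ih2 => exact congrArg₂ (Formula.bin c) ih1 ih2
  | quant q x φ ih => exact congrArg (Formula.quant q x) ih

theorem avoids_lift (F : Finset ℕ) : Avoids (Θ := Θ) (C := Θ.Const) (C' := Θ.Const ⊕ U)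
    (fun c => .const (.inl c)) F := avoids_of_closed (fun _ => rfl) F

theorem Formula.notMem_fv_lift {φ : Formula Θ} {x : ℕ} (h : x ∉ φ.fv) : x ∉ (φ.lift U).fv := by
  rw [lift_eq_kmap]
  exact notMem_fv_kmap (avoids_lift _) h

end
end QmbC

namespace QmbC

/-! ## Soundness -/

namespace Formula
variable {Θ : Signature.{u, v}}

theorem subst_update_substVar (φ : Formula Θ) {σ : ℕ → Term Θ} (hσ : ∀ x, (σ x).vars = ∅) (x : ℕ)
    (t : Term Θ) :
    (φ.subst (Function.update σ x (Term.var x))).substVar x t =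
      φ.subst (Function.update σ x t) := by
  rw [substVar, subst_subst (Safe.noCapture ((safe_of_closed hσ).update_var x) φ)]
  congr 1
  funext y
  by_cases h : y = x
  · subst h; simp [Term.subst]
  · simp [h, Term.subst_of_closed (hσ y)]

theorem substVar_subst {φ : Formula Θ} {x : ℕ} {t : Term Θ} (h : FreeFor t x φ)
    (σ : ℕ → Term Θ) :
    (φ.substVar x t).subst σ = φ.subst (Function.update σ x (t.subst σ)) := by
  rw [substVar, subst_subst h.noCapture]
  congr 1
  funext y
  by_cases h : y = x
  · subst h; simp
  · simp [h, Term.subst]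

end Formula

section
variable {Θ : Signature.{u, v}} {U : Type w}

theorem comp_update_name (μ : ℕ → U) (x : ℕ) (b : U) :
    Function.update (fun y => name (Θ := Θ) (μ y)) x (name b) =
      fun y => name (Function.update μ x b y) := by
  funext y
  by_cases h : y = x
  · subst h; simp
  · simp [h]

theorem Formula.close_substVar_name (φ : Formula (Θ.diagram U)) (μ : ℕ → U) (x : ℕ) (b : U) :
    (φ.substVar x (name b)).close μ = φ.close (Function.update μ x b) := by
  rw [close, substVar_subst (freeFor_of_closed rfl x φ), close]
  exact congrArg (fun σ => subst σ φ) (comp_update_name μ x b)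

theorem Formula.isSentence_close (φ : Formula (Θ.diagram U)) (μ : ℕ → U) :
    (φ.close μ).IsSentence := isSentence_subst (fun _ => rfl) φ

theorem Formula.close_congr {φ : Formula (Θ.diagram U)} {μ ν : ℕ → U}
    (h : ∀ x ∈ φ.fv, μ x = ν x) : φ.close μ = φ.close ν :=
  subst_congr fun x hx => congrArg name (h x hx)

theorem Formula.close_update_of_notMem {φ : Formula (Θ.diagram U)} {x : ℕ} (h : x ∉ φ.fv)
    (μ : ℕ → U) (b : U) : φ.close (Function.update μ x b) = φ.close μ :=
  close_congr fun y hy => by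
    have : y ≠ x := fun e => h (e ▸ hy)
    simp [this]

variable {A : Type a} [CompleteBooleanAlgebra A] {B : SwapStructure A} {S : Struc Θ U B}

theorem Struc.eval_subst (S : Struc Θ U B) (μ : ℕ → U) (σ : ℕ → Term Θ) (t : Term Θ) :
    S.eval μ (t.subst σ) = S.eval (fun x => S.eval μ (σ x)) t := by
  induction t with
  | var x => rfl
  | const c => rfl
  | func f ts ih => exact congrArg (S.func f) (funext ih)

theorem Struc.eval_congr (S : Struc Θ U B) {μ ν : ℕ → U} {t : Term Θ}
    (h : ∀ x ∈ t.vars, μ x = ν x) : S.eval μ t = S.eval ν t := by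
  induction t with
  | var x => exact h x (by simp [Term.vars])
  | const c => rfl
  | func f ts ih =>
    exact congrArg (S.func f) (funext fun i => ih i fun x hx => h x (Term.mem_vars_func.2 ⟨i, hx⟩))

namespace IsValuation
variable {val : Formula (Θ.diagram U) → B.carrier}

open Formula

theorem close_atom (hv : IsValuation S val) (p : Θ.Pred)
    (ts : Fin (Θ.predArity p) → Term (Θ.diagram U)) (μ : ℕ → U) :
    val (close μ (Formula.atom (Θ := Θ.diagram U) p ts)) =
      S.pred p fun i => S.expand.eval μ (ts i) := by
  refine (hv.atom p _ (isSentence_close (Formula.atom (Θ := Θ.diagram U) p ts) μ) μ).trans ?_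
  congr 1
  funext i
  rw [Struc.eval_subst]
  rfl

/-- The substitution lemma. Values of subformulas do not determine the value of a compound, so each
inductive step rests on clause (vi); only atoms are computed. -/
theorem close_substVar (hv : IsValuation S val) {φ : Formula (Θ.diagram U)} {z : ℕ}
    {t : Term (Θ.diagram U)} (hf : FreeFor t z φ) (μ : ℕ → U) :
    val (close μ (φ.substVar z t)) = val (close μ (φ.substVar z (name (S.expand.eval μ t)))) := by
  induction φ generalizing μ with
  | atom p ts =>
    refine (hv.close_atom p _ μ).trans (Eq.trans ?_ (hv.close_atom p _ μ).symm)
    congr 1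
    funext i
    rw [Struc.eval_subst, Struc.eval_subst]
    congr 1
    funext y
    by_cases h : y = z
    · subst h
      simp only [Function.update_self]
      rfl
    · simp [h]
  | un c φ ih => exact hv.subst_un c φ z t hf μ (ih hf μ)
  | bin c φ ψ ih1 ih2 => exact hv.subst_bin c φ ψ z t hf.1 hf.2 μ (ih1 hf.1 μ) (ih2 hf.2 μ)
  | quant q x φ ih =>
    by_cases hz : z ∈ φ.fv.erase x
    · obtain ⟨hx, hf⟩ := hf.resolve_left (not_not.2 hz)
      -- As `x` does not occur in `t`, changing `μ` at `x` leaves the value of `t` alone.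
      refine hv.subst_quant q φ z t hf μ x (Finset.ne_of_mem_erase hz).symm hx fun b => ?_
      rw [ih hf, Struc.eval_congr S.expand (ν := μ)]
      intro y hy
      have : y ≠ x := fun e => hx (e ▸ hy)
      simp [this]
    · rw [substVar_of_notMem hz, substVar_of_notMem hz]

theorem close_substVar_eq (hv : IsValuation S val) {φ : Formula (Θ.diagram U)} {z : ℕ}
    {t : Term (Θ.diagram U)} (hf : FreeFor t z φ) (μ : ℕ → U) :
    val (close μ (φ.substVar z t)) = val (close (Function.update μ z (S.expand.eval μ t)) φ) := by
  rw [hv.close_substVar hf, close_substVar_name]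

theorem close_bin_fst (hv : IsValuation S val) (c : BinConn) (φ ψ : Formula (Θ.diagram U))
    (μ : ℕ → U) :
    (val (close μ (.bin c φ ψ))).1.1 = c.op (val (close μ φ)).1.1 (val (close μ ψ)).1.1 :=
  B.bin_fst _ _ _ _ (hv.bin c _ _ (isSentence_close φ μ) (isSentence_close ψ μ))

theorem close_un_fst (hv : IsValuation S val) (c : UnConn) (φ : Formula (Θ.diagram U))
    (μ : ℕ → U) : (val (close μ (.un c φ))).1.1 = c.proj (val (close μ φ)).1 :=
  B.un_fst _ _ _ (hv.un c _ (isSentence_close φ μ))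

theorem close_quant_fst (hv : IsValuation S val) (q : Quant) (x : ℕ) (φ : Formula (Θ.diagram U))
    (μ : ℕ → U) : (val (close μ (.quant q x φ))).1.1 =
      q.op fun b => (val (close (Function.update μ x b) φ)).1.1 := by
  refine (hv.quant q x _ (isSentence_close (.quant q x φ) μ)).trans ?_
  congr 1
  funext b
  rw [subst_update_substVar φ (fun _ => rfl), comp_update_name]
  rfl

theorem close_imp_mem (hv : IsValuation S val) {φ ψ : Formula (Θ.diagram U)} {μ : ℕ → U} :
    val (close μ (φ.imp ψ)) ∈ B.D ↔ (val (close μ φ)).1.1 ≤ (val (close μ ψ)).1.1 := by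
  change (val (close μ (.bin .imp φ ψ))).1.1 = ⊤ ↔ _
  rw [hv.close_bin_fst]
  exact himp_eq_top_iff

theorem close_all_mem (hv : IsValuation S val) {φ : Formula (Θ.diagram U)} {x : ℕ} {μ : ℕ → U} :
    val (close μ (all x φ)) ∈ B.D ↔ ∀ b, val (close (Function.update μ x b) φ) ∈ B.D := by
  change (val (close μ (.quant .all x φ))).1.1 = ⊤ ↔ _
  rw [hv.close_quant_fst]
  exact iInf_eq_top

/-- Everything is read off first coordinates. (A9) uses complements, (A10) and (A11) use the
defining conditions of snapshots, the quantifier axioms use the substitution lemma, and (Ax14) uses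
clause (vii). -/
theorem ax_mem (hv : IsValuation S val) {φ : Formula (Θ.diagram U)} (h : QmbCAx φ) (μ : ℕ → U) :
    val (close μ φ) ∈ B.D := by
  cases h with
  | a1 α β =>
    simp only [close_imp_mem hv, close_bin_fst hv, BinConn.op]
    simp
  | a2 α β γ =>
    simp only [close_imp_mem hv, close_bin_fst hv, BinConn.op, le_himp_iff]
    generalize (val (close μ α)).1.1 = a
    generalize (val (close μ β)).1.1 = b
    generalize (val (close μ γ)).1.1 = c
    have h1 : (a ⇨ b ⇨ c) ⊓ (a ⇨ b) ⊓ a ≤ b :=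
      (inf_le_inf_right a inf_le_right).trans himp_inf_le
    have h2 : (a ⇨ b ⇨ c) ⊓ (a ⇨ b) ⊓ a ≤ b ⇨ c :=
      (inf_le_inf_right a inf_le_left).trans himp_inf_le
    exact (le_inf h2 h1).trans himp_inf_le
  | a3 α β =>
    simp only [close_imp_mem hv, close_bin_fst hv, BinConn.op, le_himp_iff]
    exact le_rfl
  | a4 α β =>
    simp only [close_imp_mem hv, close_bin_fst hv, BinConn.op]
    exact inf_le_left
  | a5 α β =>
    simp only [close_imp_mem hv, close_bin_fst hv, BinConn.op]
    exact inf_le_right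
  | a6 α β =>
    simp only [close_imp_mem hv, close_bin_fst hv, BinConn.op]
    exact le_sup_left
  | a7 α β =>
    simp only [close_imp_mem hv, close_bin_fst hv, BinConn.op]
    exact le_sup_right
  | a8 α β γ =>
    simp only [close_imp_mem hv, close_bin_fst hv, BinConn.op, le_himp_iff]
    rw [inf_sup_left]
    exact sup_le ((inf_le_inf_right _ inf_le_left).trans himp_inf_le)
      ((inf_le_inf_right _ inf_le_right).trans himp_inf_le)
  | a9 α β =>
    change (val (close μ (.bin .or α (.bin .imp α β)))).1.1 = ⊤
    simp only [close_bin_fst hv, BinConn.op, himp_eq]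
    rw [sup_left_comm, sup_compl_eq_top, sup_top_eq]
  | a10 α =>
    change (val (close μ (.bin .or α (.un .neg α)))).1.1 = ⊤
    simp only [close_bin_fst hv, close_un_fst hv, BinConn.op, UnConn.proj]
    exact B.sup_eq_top _ (val (close μ α)).2
  | a11 α β =>
    simp only [close_imp_mem hv, close_bin_fst hv, close_un_fst hv, BinConn.op, UnConn.proj,
      le_himp_iff]
    refine (le_of_eq ?_).trans bot_le
    rw [← B.inf_eq_bot _ (val (close μ α)).2]
    ac_rfl
  | ax12 φ x t hf =>
    rw [close_imp_mem hv, hv.close_substVar_eq hf, hv.close_quant_fst]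
    exact le_iSup (fun b => (val (close (Function.update μ x b) φ)).1.1) _
  | ax13 φ x t hf =>
    rw [close_imp_mem hv, hv.close_substVar_eq hf, hv.close_quant_fst]
    exact iInf_le (fun b => (val (close (Function.update μ x b) φ)).1.1) _
  | ax14 α β h =>
    rw [close_imp_mem hv, hv.variant _ _ (isSentence_close α μ) (isSentence_close β μ)
      (h.subst (safe_of_closed fun _ => rfl))]

end IsValuation
end

theorem IsValuationEq.ax_mem {Θ : Signature.{u, v}} {U : Type w} {A : Type a}
    [CompleteBooleanAlgebra A] {B : SwapStructure A} {S : Struc Θ.withEq U B}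
    {val : Formula (Θ.withEq.diagram U) → B.carrier} (hS : HasStandardEq S)
    (hv : IsValuationEq S val) {φ : Formula (Θ.withEq.diagram U)}
    (h : EqAx (Θ := Θ.withEq.diagram U) none rfl φ) (μ : ℕ → U) : val (φ.close μ) ∈ B.D := by
  cases h with
  | qmbc h => exact hv.toIsValuation.ax_mem h μ
  | axEq1 x =>
    refine hv.toIsValuation.close_all_mem.2 fun b => ?_
    have e := hv.toIsValuation.close_atom none
      (![Term.var x, Term.var x] : Fin 2 → Term (Θ.withEq.diagram U)) (Function.update μ x b)
    refine e.symm ▸ ?_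
    have h := (hS b b).2 rfl
    convert h using 1
    refine congrArg (S.pred none) (funext fun i => ?_)
    change S.expand.eval (Function.update μ x b) (![Term.var x, Term.var x] i) = ![b, b] i
    fin_cases i <;> exact Function.update_self x b μ
  | axEq2 h => exact hv.axEq2 φ μ h

/-- Designation is required under all assignments at once, which is what the quantifier rules need:
the induction hypothesis applies at every `μ^x_b`, and the side condition makes the other formula
insensitive to `b`. -/
theorem EntailsEq.of_derivesEq {Θ : Signature.{u, v}} {Γ : Set (Formula Θ.withEq)}
    {φ : Formula Θ.withEq} (h : DerivesEq Γ φ) : EntailsEq.{u, v, w, a} Γ φ := by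
  intro A _ B U _ S hS val hv hΓ
  have hv' := hv.toIsValuation
  rw [derivesEq_iff] at h
  induction h with
  | ax h =>
    intro μ
    refine hv.ax_mem hS ?_ μ
    rw [Formula.lift_eq_kmap]
    obtain ⟨F, h⟩ := EqAx.kmap (Θ := Θ.withEq) (C := Θ.Const) (C' := Θ.Const ⊕ U) h
    exact h _ (avoids_lift _)
  | hyp h => exact hΓ _ h
  | mp _ _ ih1 ih2 =>
    intro μ
    exact top_le_iff.1 ((ih1 μ).symm.le.trans (hv'.close_imp_mem.1 (ih2 μ)))
  | @exIn φ ψ x hx _ ih =>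
    intro μ
    refine hv'.close_imp_mem.2 ?_
    refine (hv'.close_quant_fst .ex x (φ.lift U) μ).le.trans (iSup_le fun b => ?_)
    have h := hv'.close_imp_mem.1 (ih (Function.update μ x b))
    rwa [Formula.close_update_of_notMem (Formula.notMem_fv_lift hx)] at h
  | @allIn φ ψ x hx _ ih =>
    intro μ
    refine hv'.close_imp_mem.2 ?_
    refine le_trans (le_iInf fun b => ?_) (hv'.close_quant_fst .all x (ψ.lift U) μ).symm.le
    have h := hv'.close_imp_mem.1 (ih (Function.update μ x b))
    rwa [Formula.close_update_of_notMem (Formula.notMem_fv_lift hx)] at h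

theorem EntailsEq.all {Θ : Signature.{u, v}} {Γ : Set (Formula Θ.withEq)}
    {φ : Formula Θ.withEq} (h : EntailsEq.{u, v, w, a} Γ φ) (x : ℕ) :
    EntailsEq.{u, v, w, a} Γ (.all x φ) := by
  intro A _ B U _ S hS val hv hΓ μ
  exact hv.toIsValuation.close_all_mem.2 fun b => h A B U S hS val hv hΓ _

end QmbC

namespace QmbC

/-! ## Derivations with local hypotheses -/

section
variable {Θ : Signature.{u, v}} {e : Θ.Pred} {he : Θ.predArity e = 2}

namespace Derives
variable {Γ : Set (Formula Θ)}
open Formula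

theorem qmbc {φ : Formula Θ} (h : QmbCAx φ) : Derives (EqAx e he) Γ φ := .ax (.qmbc h)

theorem imp_self (φ : Formula Θ) : Derives (EqAx e he) Γ (φ.imp φ) :=
  .mp (.qmbc (.a1 φ φ)) (.mp (.qmbc (.a1 φ (φ.imp φ))) (.qmbc (.a2 φ (φ.imp φ) φ)))

theorem imp_of {φ : Formula Θ} (h : Derives (EqAx e he) Γ φ) (ψ : Formula Θ) :
    Derives (EqAx e he) Γ (ψ.imp φ) := .mp h (.qmbc (.a1 φ ψ))

theorem all {φ : Formula Θ} (h : Derives (EqAx e he) Γ φ) (x : ℕ) :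
    Derives (EqAx e he) Γ (Formula.all x φ) :=
  .mp (imp_self (Formula.all x φ)) (.allIn x (by simp [fv]) (h.imp_of _))

theorem substVar {φ : Formula Θ} (h : Derives (EqAx e he) Γ φ) {x : ℕ} {t : Term Θ}
    (ht : FreeFor t x φ) : Derives (EqAx e he) Γ (φ.substVar x t) :=
  .mp (h.all x) (.qmbc (.ax13 φ x t ht))

theorem of_all {φ : Formula Θ} {x : ℕ} (h : Derives (EqAx e he) Γ (Formula.all x φ)) :
    Derives (EqAx e he) Γ φ := by
  have := Derives.mp h (.qmbc (.ax13 φ x (.var x) (freeFor_self x φ)))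
  rwa [substVar_self] at this

/-- Generalization and (Ax13) substitute for one variable at a time. Since the terms are closed,
later substitutions do not touch earlier ones, and the result is the simultaneous substitution. -/
theorem subst_closed {φ : Formula Θ} (h : Derives (EqAx e he) Γ φ) {σ : ℕ → Term Θ}
    (hσ : ∀ x, (σ x).vars = ∅) : Derives (EqAx e he) Γ (φ.subst σ) := by
  have key : ∀ s : Finset ℕ,
      Derives (EqAx e he) Γ (φ.subst fun x => if x ∈ s then σ x else .var x) := by
    intro s
    induction s using Finset.induction_on with
    | empty => simpa using h
    | insert x s hx ih =>
      have hs : Safe fun x => if x ∈ s then σ x else .var x := by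
        intro y
        by_cases hy : y ∈ s
        · exact .inr (by simp [hy, hσ])
        · exact .inl (by simp [hy])
      have := ih.substVar (freeFor_of_closed (hσ x) x _)
      rw [Formula.substVar, subst_subst (Safe.noCapture hs φ)] at this
      convert this using 2
      funext y
      by_cases hy : y ∈ s
      · simp [hy, Term.subst_of_closed (hσ y)]
      · by_cases hyx : y = x
        · subst hyx; simp [hy, Term.subst]
        · simp [hy, hyx, Term.subst]
  have h := key φ.fv
  rwa [subst_congr (τ := σ) fun x hx => by simp [hx]] at h

end Derives

/-- Closure under modus ponens of the theorems of `Γ` together with the formulas of `T`. -/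
inductive LocalDerives (e : Θ.Pred) (he : Θ.predArity e = 2) (Γ T : Set (Formula Θ)) :
    Formula Θ → Prop
  | thm {φ : Formula Θ} : Derives (EqAx e he) Γ φ → LocalDerives e he Γ T φ
  | hyp {φ : Formula Θ} : φ ∈ T → LocalDerives e he Γ T φ
  | mp {φ ψ : Formula Θ} : LocalDerives e he Γ T φ → LocalDerives e he Γ T (φ.imp ψ) →
      LocalDerives e he Γ T ψ

namespace LocalDerives
variable {Γ T T' : Set (Formula Θ)}
open Formula

theorem ax {φ : Formula Θ} (h : QmbCAx φ) : LocalDerives e he Γ T φ := .thm (.qmbc h)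

theorem cut {φ : Formula Θ} (h : LocalDerives e he Γ T φ)
    (hT : ∀ ψ ∈ T, LocalDerives e he Γ T' ψ) : LocalDerives e he Γ T' φ := by
  induction h with
  | thm h => exact .thm h
  | hyp h => exact hT _ h
  | mp _ _ ih1 ih2 => exact .mp ih1 ih2

theorem mono {φ : Formula Θ} (h : LocalDerives e he Γ T φ) (hT : T ⊆ T') :
    LocalDerives e he Γ T' φ := h.cut fun _ hψ => .hyp (hT hψ)

/-- The deduction theorem without side conditions: the quantifier rules are never applied below a
local hypothesis. -/
theorem imp_intro {φ ψ : Formula Θ} (h : LocalDerives e he Γ (insert φ T) ψ) :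
    LocalDerives e he Γ T (φ.imp ψ) := by
  induction h with
  | thm h => exact .thm (h.imp_of _)
  | hyp h =>
    rcases h with rfl | h
    · exact .thm (.imp_self _)
    · exact .mp (.hyp h) (.ax (.a1 _ _))
  | mp _ _ ih1 ih2 => exact .mp ih1 (.mp ih2 (.ax (.a2 _ _ _)))

theorem or_elim {φ ψ χ : Formula Θ} (h : LocalDerives e he Γ T (φ.or ψ))
    (h1 : LocalDerives e he Γ (insert φ T) χ) (h2 : LocalDerives e he Γ (insert ψ T) χ) :
    LocalDerives e he Γ T χ :=
  .mp h (.mp h2.imp_intro (.mp h1.imp_intro (.ax (.a8 _ _ _))))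

theorem derives {φ : Formula Θ} (h : LocalDerives e he Γ ∅ φ) : Derives (EqAx e he) Γ φ := by
  induction h with
  | thm h => exact h
  | hyp h => exact absurd h (Set.notMem_empty _)
  | mp _ _ ih1 ih2 => exact .mp ih1 ih2

theorem foldr_imp (L : List (Formula Θ)) (φ : Formula Θ) :
    LocalDerives e he Γ (T ∪ {ψ | ψ ∈ L}) φ ↔ LocalDerives e he Γ T (L.foldr Formula.imp φ) := by
  induction L generalizing T with
  | nil => simp
  | cons α L ih =>
    constructor
    · intro h
      refine imp_intro (ih.1 (h.mono ?_))
      rintro ψ (hψ | hψ)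
      · exact .inl (.inr hψ)
      · rcases List.mem_cons.1 hψ with rfl | hψ
        · exact .inl (.inl rfl)
        · exact .inr hψ
    · intro h
      have h' : LocalDerives e he Γ (insert α T) (L.foldr Formula.imp φ) :=
        .mp (.hyp (.inl rfl)) (h.mono (Set.subset_insert α T))
      refine (ih.2 h').mono ?_
      rintro ψ ((rfl | hψ) | hψ)
      · exact .inr (by simp)
      · exact .inl hψ
      · exact .inr (List.mem_cons_of_mem _ hψ)

theorem exists_finset {ι : Type w} {f : ι → Formula Θ} {φ : Formula Θ}
    (h : LocalDerives e he Γ (Set.range f) φ) :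
    ∃ s : Finset ι, LocalDerives e he Γ (f '' (s : Set ι)) φ := by
  classical
  induction h with
  | thm h => exact ⟨∅, .thm h⟩
  | hyp h =>
    obtain ⟨i, rfl⟩ := h
    exact ⟨{i}, .hyp ⟨i, by simp, rfl⟩⟩
  | mp _ _ ih1 ih2 =>
    obtain ⟨s, h1⟩ := ih1
    obtain ⟨t, h2⟩ := ih2
    exact ⟨s ∪ t, .mp (h1.mono (Set.image_mono (by simp))) (h2.mono (Set.image_mono (by simp)))⟩

/-- Finiteness of derivations in the form that Zorn's lemma needs. -/
theorem exists_mem_of_sUnion {c : Set (Set (Formula Θ))} (hc : IsChain (· ⊆ ·) c)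
    (hne : c.Nonempty) {φ : Formula Θ} (h : LocalDerives e he Γ (⋃₀ c) φ) :
    ∃ S ∈ c, LocalDerives e he Γ S φ := by
  induction h with
  | thm h => exact hne.imp fun S hS => ⟨hS, .thm h⟩
  | hyp h =>
    obtain ⟨S, hS, h⟩ := h
    exact ⟨S, hS, .hyp h⟩
  | mp _ _ ih1 ih2 =>
    obtain ⟨S, hS, h1⟩ := ih1
    obtain ⟨S', hS', h2⟩ := ih2
    rcases hc.total hS hS' with h | h
    · exact ⟨S', hS', .mp (h1.mono h) h2⟩
    · exact ⟨S, hS, .mp h1 (h2.mono h)⟩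

end LocalDerives

open Formula in
/-- A hypothesis `φ[x/y] → ∀x φ`, for a fresh variable `y`, can be dropped. -/
theorem Derives.of_instance_imp_all {Γ : Set (Formula Θ)} {φ θ : Formula Θ} {x y : ℕ}
    (hf : FreeFor (.var y) x φ) (hy : y ∉ φ.fv) (hyθ : y ∉ θ.fv)
    (h : Derives (EqAx e he) Γ (((φ.substVar x (.var y)).imp (Formula.all x φ)).imp θ)) :
    Derives (EqAx e he) Γ θ := by
  set p := φ.substVar x (.var y) with hp
  set q := Formula.all x φ with hq
  -- By (A9), either `p` or `p → q`. In the second case the premise gives `θ`, hence `q`, and `q`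
  -- has `p` as an instance.
  have h1 : LocalDerives e he Γ {θ.imp q} p := by
    refine .or_elim (φ := p) (ψ := p.imp q) (.ax (.a9 p q)) (.hyp (.inl rfl)) ?_
    have hθ : LocalDerives e he Γ (insert (p.imp q) {θ.imp q}) θ :=
      .mp (.hyp (.inl rfl)) (.thm h)
    exact .mp (.mp hθ (.hyp (.inr rfl))) (.ax (.ax13 φ x (.var y) hf))
  have h2 : Derives (EqAx e he) Γ ((θ.imp q).imp p) :=
    LocalDerives.derives (LocalDerives.imp_intro (h1.mono (by simp)))
  -- As `y` is not free in `θ → q`, one may generalize over it; `∀y p` is a variant of `q`, so `θ →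
  -- q` yields `q`.
  have h3 : Derives (EqAx e he) Γ ((θ.imp q).imp (Formula.all y p)) :=
    .allIn y (by simp [fv, hq, hy, hyθ]) h2
  have h4 : Derives (EqAx e he) Γ ((Formula.all y p).imp q) :=
    .qmbc (.ax14 _ _ (.symm (.rename .all x y φ hy hf)))
  -- (A9) once more: either `θ`, or `θ → q`, which yields `q`, hence `p → q`, hence `θ`.
  refine LocalDerives.derives (.or_elim (φ := θ) (ψ := θ.imp q) (.ax (.a9 θ q))
    (.hyp (.inl rfl)) ?_)
  have h5 : LocalDerives e he Γ (insert (θ.imp q) ∅) q :=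
    .mp (.mp (.hyp (.inl rfl)) (.thm h3)) (.thm h4)
  exact .mp (.mp h5 (.ax (.a1 q p))) (.thm h)

end

/-! ## Occurrences of constants -/

section
variable {Θ : Signature.{u, v}}

/-- The constants occurring in a term. -/
def Term.consts : Term Θ → Set Θ.Const
  | .var _ => ∅
  | .const c => {c}
  | .func _ ts => ⋃ i, (ts i).consts

/-- The constants occurring in a formula. -/
def Formula.consts : Formula Θ → Set Θ.Const
  | .atom _ ts => ⋃ i, (ts i).consts
  | .un _ φ => φ.consts
  | .bin _ φ ψ => φ.consts ∪ ψ.consts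
  | .quant _ _ φ => φ.consts

theorem Term.mem_consts_subst {t : Term Θ} {σ : ℕ → Term Θ} {c : Θ.Const}
    (h : c ∈ (t.subst σ).consts) : c ∈ t.consts ∨ ∃ x, c ∈ (σ x).consts := by
  induction t with
  | var x => exact .inr ⟨x, h⟩
  | const d => exact .inl h
  | func f ts ih =>
    obtain ⟨i, hi⟩ := Set.mem_iUnion.1 h
    exact (ih i hi).imp_left fun h => Set.mem_iUnion.2 ⟨i, h⟩

theorem Formula.mem_consts_subst {φ : Formula Θ} {σ : ℕ → Term Θ} {c : Θ.Const}
    (h : c ∈ (φ.subst σ).consts) : c ∈ φ.consts ∨ ∃ x, c ∈ (σ x).consts := by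
  induction φ generalizing σ with
  | atom p ts =>
    obtain ⟨i, hi⟩ := Set.mem_iUnion.1 h
    exact (Term.mem_consts_subst hi).imp_left fun h => Set.mem_iUnion.2 ⟨i, h⟩
  | un c φ ih => exact ih h
  | bin c φ ψ ih1 ih2 =>
    rcases h with h | h
    · exact (ih1 h).imp_left .inl
    · exact (ih2 h).imp_left .inr
  | quant q x φ ih =>
    refine (ih h).imp_right ?_
    rintro ⟨z, hz⟩
    by_cases hzx : z = x
    · subst hzx; simp [Term.consts] at hz
    · exact ⟨z, by simpa [hzx] using hz⟩

theorem Formula.mem_consts_substVar {φ : Formula Θ} {x : ℕ} {t : Term Θ} {c : Θ.Const}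
    (h : c ∈ (φ.substVar x t).consts) : c ∈ φ.consts ∨ c ∈ t.consts := by
  refine (mem_consts_subst h).imp_right ?_
  rintro ⟨z, hz⟩
  by_cases hzx : z = x
  · subst hzx; simpa using hz
  · simp [hzx, Term.consts] at hz

variable {C : Type w}

theorem Term.kmap_eq_self {k : C → Term (Θ.setConst C)} {t : Term (Θ.setConst C)}
    (h : ∀ c ∈ t.consts, k c = .const c) : t.kmap k = t := by
  induction t with
  | var x => rfl
  | const c => exact h c rfl
  | func f ts ih =>
    exact congrArg (Term.func (Θ := Θ.setConst C) f)
      (funext fun i => ih i fun c hc => h c (Set.mem_iUnion.2 ⟨i, hc⟩))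

theorem Formula.kmap_eq_self {k : C → Term (Θ.setConst C)} {φ : Formula (Θ.setConst C)}
    (h : ∀ c ∈ φ.consts, k c = .const c) : φ.kmap k = φ := by
  induction φ with
  | atom p ts =>
    exact congrArg (Formula.atom (Θ := Θ.setConst C) p)
      (funext fun i => Term.kmap_eq_self fun c hc => h c (Set.mem_iUnion.2 ⟨i, hc⟩))
  | un c φ ih => exact congrArg (Formula.un c) (ih h)
  | bin c φ ψ ih1 ih2 =>
    exact congrArg₂ (Formula.bin c) (ih1 fun c hc => h c (.inl hc)) (ih2 fun c hc => h c (.inr hc))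
  | quant q x φ ih => exact congrArg (Formula.quant q x) (ih h)

/-- Replacing `c` by a fresh variable throughout the derivation leaves `Γ`, `φ` and `θ` unchanged,
and turns the Henkin hypothesis into one that `Derives.of_instance_imp_all` removes. -/
theorem Derives.of_witness {e : Θ.Pred} {he : Θ.predArity e = 2} {Γ : Set (Formula (Θ.setConst C))}
    {c : C} (hΓ : ∀ γ ∈ Γ, c ∉ γ.consts) {φ θ : Formula (Θ.setConst C)} (hφ : c ∉ φ.consts)
    (hθ : c ∉ θ.consts) {x : ℕ}
    (h : Derives (EqAx (Θ := Θ.setConst C) e he) Γ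
      (((φ.substVar x (.const c)).imp (.all x φ)).imp θ)) :
    Derives (EqAx (Θ := Θ.setConst C) e he) Γ θ := by
  classical
  obtain ⟨F, hF⟩ := h.kmap (C' := C)
  obtain ⟨y, hy⟩ := Infinite.exists_notMem_finset (F ∪ {x} ∪ φ.fv ∪ φ.bv ∪ θ.fv)
  simp only [Finset.mem_union, Finset.mem_singleton, not_or] at hy
  obtain ⟨⟨⟨⟨hyF, hyx⟩, hyφ⟩, hyb⟩, hyθ⟩ := hy
  set k : C → Term (Θ.setConst C) :=
    Function.update (Term.const (Θ := Θ.setConst C)) c (.var y) with hk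
  have hkv : ∀ d, ∀ z ∈ (k d).vars, z = y := by
    intro d z hz
    by_cases hd : d = c
    · subst hd; simpa [hk, Term.vars] using hz
    · simp [hk, hd, Term.vars] at hz
  have hkc : ∀ ψ : Formula (Θ.setConst C), c ∉ ψ.consts → ψ.kmap k = ψ := fun ψ hψ =>
    Formula.kmap_eq_self fun d hd => by
      have : d ≠ c := fun e => hψ (e ▸ hd)
      simp [hk, this]
  have h' := hF k fun d z hz => hkv d z hz ▸ hyF
  have hΓ' : Formula.kmap k '' Γ = Γ := by
    ext γ
    constructor
    · rintro ⟨γ, hγ, rfl⟩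
      rwa [hkc γ (hΓ γ hγ)]
    · intro hγ
      exact ⟨γ, hγ, hkc γ (hΓ γ hγ)⟩
  rw [hΓ'] at h'
  have e1 : (φ.substVar x (.const c)).kmap k = φ.substVar x (.var y) := by
    refine (Formula.kmap_substVar fun d z hz => ?_).trans ?_
    · simpa [hkv d z hz] using hyx
    · rw [hkc φ hφ]
      change φ.substVar x (k c) = _
      simp [hk]
  have e2 : Formula.kmap k (((φ.substVar x (.const c)).imp (.all x φ)).imp θ) =
      ((φ.substVar x (.var y)).imp (.all x φ)).imp θ := by
    change Formula.imp (Formula.imp ((φ.substVar x (.const c)).kmap k) (.all x (φ.kmap k)))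
      (θ.kmap k) = _
    rw [e1, hkc φ hφ, hkc θ hθ]
  rw [e2] at h'
  exact h'.of_instance_imp_all
    (Formula.freeFor_of_disjoint (by simpa [Term.vars] using hyb) x) hyφ hyθ

end

/-! ## Henkin constants -/

/-- Codes of the formulas of a language that has every code as an additional constant. -/
inductive Code (Θ : Signature.{u, v}) : Type (max u v)
  | var (x : ℕ) : Code Θ
  | const (c : Θ.Const) : Code Θ
  | name (c : Code Θ) : Code Θ
  | func (f : Θ.Func) (ts : Fin (Θ.funcArity f) → Code Θ) : Code Θ
  | atom (p : Θ.Pred) (ts : Fin (Θ.predArity p) → Code Θ) : Code Θ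
  | un (c : UnConn) (φ : Code Θ) : Code Θ
  | bin (c : BinConn) (φ ψ : Code Θ) : Code Θ
  | quant (q : Quant) (x : ℕ) (φ : Code Θ) : Code Θ

section
variable {Θ : Signature.{u, v}}

namespace Code

/-- Only nestings of `name` are counted, so the code of a formula lies strictly deeper than every
added constant occurring in it. One inductive type thereby replaces the usual increasing chain of
languages. -/
def depth : Code Θ → ℕ
  | var _ => 0
  | const _ => 0
  | name c => c.depth + 1
  | func _ ts => Finset.univ.sup fun i => (ts i).depth
  | atom _ ts => Finset.univ.sup fun i => (ts i).depth
  | un _ φ => φ.depth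
  | bin _ φ ψ => max φ.depth ψ.depth
  | quant _ _ φ => φ.depth

def ofTerm : Term (Θ.diagram (Code Θ)) → Code Θ
  | .var x => var x
  | .const (.inl c) => const c
  | .const (.inr c) => name c
  | .func f ts => func f fun i => ofTerm (ts i)

def ofFormula : Formula (Θ.diagram (Code Θ)) → Code Θ
  | .atom p ts => atom p fun i => ofTerm (ts i)
  | .un c φ => un c (ofFormula φ)
  | .bin c φ ψ => bin c (ofFormula φ) (ofFormula ψ)
  | .quant q x φ => quant q x (ofFormula φ)

theorem ofTerm_injective : Function.Injective (ofTerm (Θ := Θ)) := by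
  intro s t h
  induction s generalizing t with
  | var x => rcases t with y | (c | c) | _ <;> simp_all [ofTerm]
  | const c => rcases c with c | c <;> rcases t with y | (d | d) | _ <;> simp_all [ofTerm]
  | func f ts ih =>
    rcases t with y | (d | d) | ⟨g, ss⟩
    · simp [ofTerm] at h
    · simp [ofTerm] at h
    · simp [ofTerm] at h
    · simp only [ofTerm, func.injEq] at h
      obtain ⟨rfl, h⟩ := h
      exact congrArg (Term.func (Θ := Θ.diagram (Code Θ)) f)
        (funext fun i => ih i (congrFun (eq_of_heq h) i))

theorem ofFormula_injective : Function.Injective (ofFormula (Θ := Θ)) := by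
  intro φ ψ h
  induction φ generalizing ψ with
  | atom p ts =>
    cases ψ with
    | atom q ss =>
      simp only [ofFormula, atom.injEq] at h
      obtain ⟨rfl, h⟩ := h
      exact congrArg (Formula.atom (Θ := Θ.diagram (Code Θ)) p)
        (funext fun i => ofTerm_injective (congrFun (eq_of_heq h) i))
    | _ => simp [ofFormula] at h
  | un c φ ih =>
    cases ψ with
    | un d ψ =>
      simp only [ofFormula, un.injEq] at h
      rw [h.1, ih h.2]
    | _ => simp [ofFormula] at h
  | bin c φ φ' ih1 ih2 =>
    cases ψ with
    | bin d ψ ψ' =>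
      simp only [ofFormula, bin.injEq] at h
      rw [h.1, ih1 h.2.1, ih2 h.2.2]
    | _ => simp [ofFormula] at h
  | quant q x φ ih =>
    cases ψ with
    | quant q' y ψ =>
      simp only [ofFormula, quant.injEq] at h
      rw [h.1, h.2.1, ih h.2.2]
    | _ => simp [ofFormula] at h

theorem depth_lt_of_mem_consts_term {t : Term (Θ.diagram (Code Θ))} {c : Code Θ}
    (h : .inr c ∈ t.consts) : c.depth < (ofTerm t).depth := by
  induction t with
  | var x => exact absurd h (Set.notMem_empty _)
  | const d =>
    obtain rfl : Sum.inr c = d := h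
    exact Nat.lt_succ_self _
  | func f ts ih =>
    obtain ⟨i, hi⟩ := Set.mem_iUnion.1 h
    exact (ih i hi).trans_le
      (Finset.le_sup (f := fun i => (ofTerm (ts i)).depth) (Finset.mem_univ i))

theorem depth_lt_of_mem_consts {φ : Formula (Θ.diagram (Code Θ))} {c : Code Θ}
    (h : .inr c ∈ φ.consts) : c.depth < (ofFormula φ).depth := by
  induction φ with
  | atom p ts =>
    obtain ⟨i, hi⟩ := Set.mem_iUnion.1 h
    exact (depth_lt_of_mem_consts_term hi).trans_le
      (Finset.le_sup (f := fun i => (ofTerm (ts i)).depth) (Finset.mem_univ i))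
  | un c φ ih => exact ih h
  | bin c φ ψ ih1 ih2 =>
    rcases h with h | h
    · exact (ih1 h).trans_le (le_max_left _ _)
    · exact (ih2 h).trans_le (le_max_right _ _)
  | quant q x φ ih => exact ih h

end Code

/-- The constant that witnesses a failure of `∀x φ`. -/
def witness (a : ℕ × Formula (Θ.diagram (Code Θ))) : Code Θ :=
  Code.ofFormula (.all a.1 a.2)

/-- The formula `φ[x/c] → ∀x φ`, where `c` is the constant that witnesses a failure of `∀x φ`. -/
def henkin (a : ℕ × Formula (Θ.diagram (Code Θ))) : Formula (Θ.diagram (Code Θ)) :=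
  (a.2.substVar a.1 (name (witness a))).imp (.all a.1 a.2)

theorem witness_injective : Function.Injective (witness (Θ := Θ)) := by
  intro a b h
  have := Code.ofFormula_injective h
  simp only [Formula.quant.injEq, true_and] at this
  exact Prod.ext this.1 this.2

theorem witness_notMem_consts (a : ℕ × Formula (Θ.diagram (Code Θ))) :
    .inr (witness a) ∉ a.2.consts := fun h =>
  (Code.depth_lt_of_mem_consts (φ := .all a.1 a.2) h).false

/-- The constants in the Henkin formula of `b` are `witness b` and constants of smaller depth;
`witness a` is not smaller, and differs from `witness b` by injectivity. -/
theorem witness_notMem_consts_henkin {a b : ℕ × Formula (Θ.diagram (Code Θ))}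
    (hab : a ≠ b) (h : (witness b).depth ≤ (witness a).depth) :
    .inr (witness a) ∉ (henkin b).consts := by
  have hb : .inr (witness a) ∉ b.2.consts := fun h' =>
    ((Code.depth_lt_of_mem_consts (φ := .all b.1 b.2) h').trans_le h).false
  rintro (h' | h')
  · rcases Formula.mem_consts_substVar h' with h' | h'
    · exact hb h'
    · exact hab (witness_injective (Sum.inr_injective h'))
  · exact hb h'

theorem consts_foldr_imp {L : List (Formula Θ)} {φ : Formula Θ} {c : Θ.Const}
    (hL : ∀ ψ ∈ L, c ∉ ψ.consts) (hφ : c ∉ φ.consts) : c ∉ (L.foldr Formula.imp φ).consts := by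
  induction L with
  | nil => exact hφ
  | cons α L ih =>
    rintro (h | h)
    · exact hL α (by simp) h
    · exact ih (fun ψ hψ => hL ψ (List.mem_cons_of_mem _ hψ)) h

variable {e : Θ.Pred} {he : Θ.predArity e = 2}

/-- Conservativity of the Henkin formulas: finitely many are used, and they are removed in order of
decreasing depth of their witnesses. -/
theorem LocalDerives.of_henkin {Γ : Set (Formula (Θ.diagram (Code Θ)))}
    (hΓ : ∀ γ ∈ Γ, ∀ c, .inr c ∉ γ.consts) {φ : Formula (Θ.diagram (Code Θ))}
    (hφ : ∀ c, .inr c ∉ φ.consts)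
    (h : LocalDerives (Θ := Θ.diagram (Code Θ)) e he Γ (Set.range henkin) φ) :
    Derives (EqAx (Θ := Θ.diagram (Code Θ)) e he) Γ φ := by
  classical
  obtain ⟨s, h⟩ := h.exists_finset
  -- The inserted `a` has the deepest witness. The remaining Henkin formulas become antecedents of
  -- `φ`, and the result does not mention that witness.
  induction s using Finset.induction_on_max_value (fun a => (witness a).depth) with
  | empty => exact LocalDerives.derives (by simpa using h)
  | insert a s ha hs ih =>
    have hset : henkin '' (s : Set _) = {ψ | ψ ∈ s.toList.map henkin} := by
      ext ψ; simp
    rw [Finset.coe_insert, Set.image_insert_eq, ← Set.singleton_union, hset,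
      LocalDerives.foldr_imp] at h
    have h' : LocalDerives (Θ := Θ.diagram (Code Θ)) e he Γ ∅
      ((henkin a).imp ((s.toList.map henkin).foldr Formula.imp φ)) :=
      LocalDerives.imp_intro (h.mono (by simp))
    have h2 := Derives.of_witness (Θ := Θ) (C := Θ.Const ⊕ Code Θ)
      (fun γ hγ => hΓ γ hγ (witness a)) (witness_notMem_consts a) (consts_foldr_imp (fun ψ hψ => by
        obtain ⟨b, hb, rfl⟩ := List.mem_map.1 hψ
        rw [Finset.mem_toList] at hb
        exact witness_notMem_consts_henkin (fun e => ha (e ▸ hb)) (hs b hb)) (hφ _)) h'.derives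
    apply ih
    rw [hset, ← Set.empty_union {ψ | _}, LocalDerives.foldr_imp]
    exact .thm h2

/-! ### Conservativity of the added constants, and existence of Henkin theories -/

theorem Formula.lift_consts {U : Type w} (φ : Formula Θ) (c : U) :
    .inr c ∉ (φ.lift U).consts := by
  have ht : ∀ t : Term Θ, .inr c ∉ (t.lift U).consts := by
    intro t h
    induction t with
    | var x => exact h
    | const d => cases h
    | func f ts ih =>
      obtain ⟨i, hi⟩ := Set.mem_iUnion.1 h
      exact ih i hi
  induction φ with
  | atom p ts =>
    intro h
    obtain ⟨i, hi⟩ := Set.mem_iUnion.1 h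
    exact ht _ hi
  | un c φ ih => exact ih
  | bin c φ ψ ih1 ih2 => exact fun h => h.elim ih1 ih2
  | quant q x φ ih => exact ih

theorem Formula.kmap_lift {U : Type w} {C : Type a} (k : Θ.Const ⊕ U → Term (Θ.setConst C))
    (φ : Formula Θ) : Formula.kmap (Θ := Θ) k (φ.lift U) =
      Formula.kmap (Θ := Θ) (C := Θ.Const) (fun c => k (.inl c)) φ := by
  have ht : ∀ t : Term Θ, Term.kmap (Θ := Θ) k (t.lift U) =
      Term.kmap (Θ := Θ) (C := Θ.Const) (fun c => k (.inl c)) t := by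
    intro t
    induction t with
    | var x => rfl
    | const d => rfl
    | func f ts ih => exact congrArg (Term.func (Θ := Θ.setConst C) f) (funext ih)
  induction φ with
  | atom p ts => exact congrArg (Formula.atom (Θ := Θ.setConst C) p) (funext fun i => ht (ts i))
  | un c φ ih => exact congrArg (Formula.un c) ih
  | bin c φ ψ ih1 ih2 => exact congrArg₂ (Formula.bin c) ih1 ih2
  | quant q x φ ih => exact congrArg (Formula.quant q x) ih

/-- All added constants are sent to one fresh variable; lifted formulas contain none of them and
come back unchanged. -/
theorem Derives.of_lift {U : Type w} {Γ : Set (Formula Θ)} {φ : Formula Θ}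
    (h : Derives (EqAx (Θ := Θ.diagram U) e he) (Formula.lift U '' Γ) (φ.lift U)) :
    Derives (EqAx e he) Γ φ := by
  obtain ⟨F, h⟩ := Derives.kmap (Θ := Θ) (C := Θ.Const ⊕ U) (C' := Θ.Const) h
  obtain ⟨y, hy⟩ := Infinite.exists_notMem_finset F
  have h := h (Sum.elim .const fun _ => .var y) (by
    rintro (c | c) z hz
    · exact absurd hz (Finset.notMem_empty z)
    · obtain rfl := Finset.mem_singleton.1 hz
      exact hy)
  have hk : ∀ ψ : Formula Θ, Formula.kmap (Θ := Θ) (C := Θ.Const ⊕ U) (C' := Θ.Const)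
      (Sum.elim .const fun _ => .var y) (ψ.lift U) = ψ := fun ψ =>
    (Formula.kmap_lift _ ψ).trans
      (Formula.kmap_eq_self (Θ := Θ) (C := Θ.Const) fun _ _ => rfl)
  rw [hk, Set.image_image] at h
  refine h.mono (fun _ h => h) ?_
  rintro _ ⟨γ, hγ, rfl⟩
  change Formula.kmap _ (γ.lift U) ∈ Γ
  rwa [hk]

/-- A theory closed under modus ponens that contains the theorems of `Γ`, is maximal among those
that do not contain `χ`, and has witnesses. -/
structure IsHenkinTheory {Θ : Signature.{u, v}} (e : Θ.Pred) (he : Θ.predArity e = 2)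
    (Γ : Set (Formula Θ)) (χ : Formula Θ) (Δ : Set (Formula Θ)) : Prop where
  thm : ∀ φ, Derives (EqAx e he) Γ φ → φ ∈ Δ
  mp : ∀ φ ψ : Formula Θ, φ ∈ Δ → φ.imp ψ ∈ Δ → ψ ∈ Δ
  notMem : χ ∉ Δ
  imp_mem : ∀ φ, φ ∉ Δ → φ.imp χ ∈ Δ
  witness : ∀ (x : ℕ) (φ : Formula Θ),
    ∃ t : Term Θ, t.vars = ∅ ∧ (φ.substVar x t).imp (.all x φ) ∈ Δ

theorem exists_isHenkinTheory {Γ : Set (Formula Θ)} {φ : Formula Θ}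
    (h : ¬ Derives (EqAx e he) Γ φ) : ∃ Δ, IsHenkinTheory (Θ := Θ.diagram (Code Θ)) e he
      (Formula.lift (Code Θ) '' Γ) (φ.lift (Code Θ)) Δ := by
  set Γ' := Formula.lift (Code Θ) '' Γ with hΓ'
  set χ := φ.lift (Code Θ) with hχ
  -- Zorn's lemma is applied to sets of local hypotheses that do not yield `χ`, starting from the
  -- Henkin formulas, which qualify by the two conservativity results.
  obtain ⟨Δ, hΔ, hmax⟩ := zorn_subset_nonempty
    {S | ¬ LocalDerives (Θ := Θ.diagram (Code Θ)) e he Γ' S χ} (fun c hc hchain hne => by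
      refine ⟨⋃₀ c, fun h => ?_, fun S hS => Set.subset_sUnion_of_mem hS⟩
      obtain ⟨S, hS, h⟩ := h.exists_mem_of_sUnion hchain hne
      exact hc hS h) (Set.range henkin) (fun h' => h (Derives.of_lift (LocalDerives.of_henkin (by
        rintro _ ⟨γ, _, rfl⟩ c
        exact Formula.lift_consts γ c) (Formula.lift_consts φ) h')))
  have hin : ∀ α, ¬ LocalDerives (Θ := Θ.diagram (Code Θ)) e he Γ' (insert α Δ) χ → α ∈ Δ :=
    fun α hα => hmax.le_of_ge hα (Set.subset_insert α Δ) (Set.mem_insert α Δ)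
  have hclosed : ∀ α, LocalDerives (Θ := Θ.diagram (Code Θ)) e he Γ' Δ α → α ∈ Δ := by
    refine fun α hα => hin α fun h' => hmax.prop (h'.cut ?_)
    rintro ψ (rfl | hψ)
    · exact hα
    · exact .hyp hψ
  refine ⟨Δ, fun α hα => hclosed α (.thm hα), fun α β h1 h2 => hclosed β (.mp (.hyp h1) (.hyp h2)),
    fun h' => hmax.prop (.hyp h'), fun α hα => ?_, fun x ψ => ?_⟩
  · exact hclosed _ (LocalDerives.imp_intro (by_contra fun h' => hα (hin α h')))
  · exact ⟨name (witness (x, ψ)), rfl, hΔ ⟨(x, ψ), rfl⟩⟩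

end
end QmbC

namespace QmbC

/-! ## Properties of Henkin theories -/

theorem Term.vars_func_of_closed {Θ : Signature.{u, v}} {f : Θ.Func}
    {ts : Fin (Θ.funcArity f) → Term Θ} (h : ∀ i, (ts i).vars = ∅) : (func f ts).vars = ∅ := by
  rw [Finset.eq_empty_iff_forall_notMem]
  intro y hy
  obtain ⟨i, hi⟩ := mem_vars_func.1 hy
  simp [h] at hi

namespace IsHenkinTheory
variable {Θ : Signature.{u, v}} {e : Θ.Pred} {he : Θ.predArity e = 2} {Γ : Set (Formula Θ)}
  {χ : Formula Θ} {Δ : Set (Formula Θ)}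
open Formula

theorem ax_mem (h : IsHenkinTheory e he Γ χ Δ) {φ : Formula Θ} (hφ : QmbCAx φ) : φ ∈ Δ :=
  h.thm _ (.qmbc hφ)

/-- Primeness: if neither disjunct is in `Δ`, maximality puts `φ → χ` and `ψ → χ` there, and (A8)
would give `χ`. -/
theorem or_mem (h : IsHenkinTheory e he Γ χ Δ) {φ ψ : Formula Θ} :
    φ.or ψ ∈ Δ ↔ φ ∈ Δ ∨ ψ ∈ Δ := by
  constructor
  · intro hor
    by_contra! hn
    exact h.notMem (h.mp _ _ hor (h.mp _ _ (h.imp_mem ψ hn.2) (h.mp _ _ (h.imp_mem φ hn.1)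
      (h.ax_mem (.a8 φ ψ χ)))))
  · rintro (hφ | hψ)
    · exact h.mp _ _ hφ (h.ax_mem (.a6 φ ψ))
    · exact h.mp _ _ hψ (h.ax_mem (.a7 φ ψ))

theorem and_mem (h : IsHenkinTheory e he Γ χ Δ) {φ ψ : Formula Θ} :
    φ.and ψ ∈ Δ ↔ φ ∈ Δ ∧ ψ ∈ Δ :=
  ⟨fun hand => ⟨h.mp _ _ hand (h.ax_mem (.a4 φ ψ)), h.mp _ _ hand (h.ax_mem (.a5 φ ψ))⟩,
    fun hand => h.mp _ _ hand.2 (h.mp _ _ hand.1 (h.ax_mem (.a3 φ ψ)))⟩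

theorem imp_mem_iff (h : IsHenkinTheory e he Γ χ Δ) {φ ψ : Formula Θ} :
    φ.imp ψ ∈ Δ ↔ (φ ∈ Δ → ψ ∈ Δ) := by
  refine ⟨fun himp hφ => h.mp _ _ hφ himp, fun himp => ?_⟩
  rcases h.or_mem.1 (h.ax_mem (.a9 φ ψ)) with hφ | hi
  · exact h.mp _ _ (himp hφ) (h.ax_mem (.a1 ψ φ))
  · exact hi

theorem mem_or_neg_mem (h : IsHenkinTheory e he Γ χ Δ) (φ : Formula Θ) : φ ∈ Δ ∨ φ.neg ∈ Δ :=
  h.or_mem.1 (h.ax_mem (.a10 φ))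

theorem not_consistent (h : IsHenkinTheory e he Γ χ Δ) {φ : Formula Θ} (h1 : φ ∈ Δ)
    (h2 : φ.neg ∈ Δ) (h3 : φ.circ ∈ Δ) : False :=
  h.notMem (h.mp _ _ h2 (h.mp _ _ h1 (h.mp _ _ h3 (h.ax_mem (.a11 φ χ)))))

theorem variant_mem (h : IsHenkinTheory e he Γ χ Δ) {φ ψ : Formula Θ} (hv : Variant φ ψ) :
    φ ∈ Δ ↔ ψ ∈ Δ :=
  ⟨fun hφ => h.mp _ _ hφ (h.ax_mem (.ax14 _ _ hv)),
    fun hψ => h.mp _ _ hψ (h.ax_mem (.ax14 _ _ hv.symm))⟩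

theorem all_mem (h : IsHenkinTheory e he Γ χ Δ) {x : ℕ} {φ : Formula Θ} :
    Formula.all x φ ∈ Δ ↔ ∀ t : Term Θ, t.vars = ∅ → φ.substVar x t ∈ Δ := by
  constructor
  · exact fun hall t ht => h.mp _ _ hall (h.ax_mem (.ax13 φ x t (freeFor_of_closed ht x φ)))
  · intro hall
    obtain ⟨t, ht, hw⟩ := h.witness x φ
    exact h.mp _ _ (hall t ht) hw

/-- Witnesses for `∃` come from those for `∀`, with `χ` as falsum: if no instance of `φ` is in `Δ`,
then `∀x (φ → χ)` is, and together with `∃x φ` it gives `χ`. Here `x` must not be free in `χ`. -/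
theorem ex_mem (h : IsHenkinTheory e he Γ χ Δ) (hχ : χ.IsSentence) {x : ℕ} {φ : Formula Θ} :
    Formula.ex x φ ∈ Δ ↔ ∃ t : Term Θ, t.vars = ∅ ∧ φ.substVar x t ∈ Δ := by
  have hx : x ∉ χ.fv := by
    rw [IsSentence] at hχ
    simp [hχ]
  constructor
  · intro hex
    by_contra! hn
    have h1 : Formula.all x (φ.imp χ) ∈ Δ := h.all_mem.2 fun t ht => by
      have e : (φ.imp χ).substVar x t = (φ.substVar x t).imp (χ.substVar x t) := rfl
      rw [e, substVar_of_notMem hx]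
      exact h.imp_mem _ (hn t ht)
    have h2 : Derives (EqAx e he) Γ ((Formula.ex x φ).imp ((Formula.all x (φ.imp χ)).imp χ)) := by
      refine .exIn x (by simp [fv, hx]) (LocalDerives.derives (LocalDerives.imp_intro
        (LocalDerives.imp_intro ?_)))
      have hi : LocalDerives e he Γ (insert (Formula.all x (φ.imp χ)) (insert φ ∅))
          ((φ.imp χ).substVar x (.var x)) :=
        .mp (.hyp (.inl rfl)) (.ax (.ax13 _ x (.var x) (freeFor_self x _)))
      rw [substVar_self] at hi
      exact .mp (.hyp (.inr (.inl rfl))) hi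
    exact h.notMem (h.mp _ _ h1 (h.mp _ _ hex (h.thm _ h2)))
  · rintro ⟨t, ht, hφ⟩
    exact h.mp _ _ hφ (h.ax_mem (.ax12 φ x t (freeFor_of_closed ht x φ)))

theorem subst_mem (h : IsHenkinTheory e he Γ χ Δ) {φ : Formula Θ}
    (hφ : Derives (EqAx e he) Γ φ) {σ : ℕ → Term Θ} (hσ : ∀ x, (σ x).vars = ∅) : φ.subst σ ∈ Δ :=
  h.thm _ (hφ.subst_closed hσ)

theorem eq_refl (h : IsHenkinTheory e he Γ χ Δ) {t : Term Θ} (ht : t.vars = ∅) :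
    binAtom e he t t ∈ Δ := by
  have := h.subst_mem (Derives.of_all (.ax (.axEq1 0))) (σ := fun _ => t) fun _ => ht
  rwa [binAtom_subst] at this

/-- (AxEq2) speaks of variables only. One replaces `x` by a fresh `y` and then substitutes closed
terms, with `t` for `y`. -/
theorem eq_subst_update (h : IsHenkinTheory e he Γ χ Δ) {σ : ℕ → Term Θ}
    (hσ : ∀ x, (σ x).vars = ∅) {x : ℕ} {t : Term Θ} (ht : t.vars = ∅)
    (heq : binAtom e he (σ x) t ∈ Δ) {φ : Formula Θ} (hφ : φ.subst σ ∈ Δ) :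
    φ.subst (Function.update σ x t) ∈ Δ := by
  obtain ⟨y, hy⟩ := Infinite.exists_notMem_finset ({x} ∪ φ.fv ∪ φ.bv)
  simp only [Finset.mem_union, Finset.mem_singleton, not_or] at hy
  obtain ⟨⟨hyx, hyφ⟩, hyb⟩ := hy
  have hf : FreeFor (.var y) x φ := freeFor_of_disjoint (by simpa [Term.vars] using hyb) x
  have hσ' : ∀ z, (Function.update σ y t z).vars = ∅ := by
    intro z
    by_cases hz : z = y
    · subst hz; simp [ht]
    · simp [hz, hσ]
  have h1 := h.subst_mem (.ax (.axEq2 (.intro x y φ _ hf (replSome_substVar x y φ)))) hσ'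
  have e1 : (binAtom e he (.var x) (.var y)).subst (Function.update σ y t) =
      binAtom e he (σ x) t := by
    rw [binAtom_subst]
    simp [Term.subst, Ne.symm hyx]
  have e2 : φ.subst (Function.update σ y t) = φ.subst σ := subst_congr fun z hz => by
    have : z ≠ y := fun e => hyφ (e ▸ hz)
    simp [this]
  have e3 : (φ.substVar x (.var y)).subst (Function.update σ y t) =
      φ.subst (Function.update σ x t) := by
    rw [substVar_subst hf]
    refine subst_congr fun z hz => ?_
    have : z ≠ y := fun e => hyφ (e ▸ hz)
    by_cases hzx : z = x
    · subst hzx; simp [Term.subst]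
    · simp [hzx, this]
  change Formula.imp (Formula.subst _ _) (Formula.imp (Formula.subst _ _) (Formula.subst _ _)) ∈ Δ
    at h1
  rw [e1, e2, e3] at h1
  exact h.mp _ _ hφ (h.mp _ _ heq h1)

theorem eq_subst (h : IsHenkinTheory e he Γ χ Δ) {σ τ : ℕ → Term Θ}
    (hσ : ∀ x, (σ x).vars = ∅) (hτ : ∀ x, (τ x).vars = ∅)
    (heq : ∀ x, binAtom e he (σ x) (τ x) ∈ Δ) {φ : Formula Θ} (hφ : φ.subst σ ∈ Δ) :
    φ.subst τ ∈ Δ := by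
  have key : ∀ s : Finset ℕ, φ.subst (fun x => if x ∈ s then τ x else σ x) ∈ Δ := by
    intro s
    induction s using Finset.induction_on with
    | empty => simpa using hφ
    | insert x s hx ih =>
      have := h.eq_subst_update (x := x) (t := τ x) (fun z => by split_ifs <;> simp [hσ, hτ])
        (hτ x) (by simpa [hx] using heq x) ih
      convert this using 2
      funext y
      by_cases hyx : y = x
      · subst hyx; simp
      · simp [hyx]
  have hk := key φ.fv
  rwa [subst_congr (τ := τ) fun x hx => by simp [hx]] at hk

/-- The left-hand side of `s ≈ s` is replaced by `t`. -/
theorem eq_symm (h : IsHenkinTheory e he Γ χ Δ) {s t : Term Θ} (hs : s.vars = ∅) (ht : t.vars = ∅)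
    (heq : binAtom e he s t ∈ Δ) : binAtom e he t s ∈ Δ := by
  have := h.eq_subst_update (σ := fun _ => s) (x := 0) (fun _ => hs) ht heq
    (φ := binAtom e he (.var 0) (.var 1)) (by rw [binAtom_subst]; exact h.eq_refl hs)
  rwa [binAtom_subst] at this

theorem eq_trans (h : IsHenkinTheory e he Γ χ Δ) {r s t : Term Θ} (hr : r.vars = ∅)
    (hs : s.vars = ∅) (ht : t.vars = ∅) (h1 : binAtom e he r s ∈ Δ) (h2 : binAtom e he s t ∈ Δ) :
    binAtom e he r t ∈ Δ := by
  have := h.eq_subst_update (σ := fun x => if x = 0 then s else t) (x := 0)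
    (fun x => by split_ifs <;> assumption) hr (h.eq_symm hr hs h1)
    (φ := binAtom e he (.var 0) (.var 1)) (by rw [binAtom_subst]; exact h2)
  rwa [binAtom_subst] at this

/-- An assignment of the terms `ts` to the first `n` variables. -/
def _root_.QmbC.assign {n : ℕ} (hn : 0 < n) (ts : Fin n → Term Θ) (x : ℕ) : Term Θ :=
  -- Variables beyond the first `n` get the value of the first one; it exists because arities are
  -- positive, and it keeps the substitution closed everywhere.
  if h : x < n then ts ⟨x, h⟩ else ts ⟨0, hn⟩

@[simp] theorem _root_.QmbC.assign_val {n : ℕ} (hn : 0 < n) (ts : Fin n → Term Θ) (i : Fin n) :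
    assign hn ts i = ts i := by
  simp [assign]

theorem eq_subst_assign (h : IsHenkinTheory e he Γ χ Δ) {n : ℕ} (hn : 0 < n)
    {ss ts : Fin n → Term Θ} (hs : ∀ i, (ss i).vars = ∅) (ht : ∀ i, (ts i).vars = ∅)
    (heq : ∀ i, binAtom e he (ss i) (ts i) ∈ Δ) {φ : Formula Θ} (hφ : φ.subst (assign hn ss) ∈ Δ) :
    φ.subst (assign hn ts) ∈ Δ := by
  refine h.eq_subst (fun x => ?_) (fun x => ?_) (fun x => ?_) hφ <;> unfold assign <;>
    split_ifs <;> simp only [hs, ht, heq]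

theorem eq_func (h : IsHenkinTheory e he Γ χ Δ) (f : Θ.Func) {ss ts : Fin (Θ.funcArity f) → Term Θ}
    (hs : ∀ i, (ss i).vars = ∅) (ht : ∀ i, (ts i).vars = ∅)
    (heq : ∀ i, binAtom e he (ss i) (ts i) ∈ Δ) :
    binAtom e he (.func f ss) (.func f ts) ∈ Δ := by
  have hc : (Term.func f ss).vars = ∅ := Term.vars_func_of_closed hs
  have := h.eq_subst_assign (Θ.funcArity_pos f) hs ht heq
    (φ := binAtom e he (.func f ss) (.func f fun i => .var i)) (by
      rw [binAtom_subst, Term.subst_of_closed hc]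
      simpa [Term.subst] using h.eq_refl hc)
  rw [binAtom_subst, Term.subst_of_closed hc] at this
  simpa [Term.subst] using this

end IsHenkinTheory

/-! ## The canonical model -/

/-- The two-valued truth value of a proposition. -/
def truth (p : Prop) : Set PUnit.{a + 1} := {_x | p}

theorem truth_eq_top {p : Prop} : truth.{a} p = ⊤ ↔ p :=
  ⟨fun h => by
    have : PUnit.unit ∈ truth.{a} p := h ▸ Set.mem_univ _
    exact this, fun h => Set.eq_univ_of_forall fun _ => h⟩

/-- The swap structure of all snapshots, with the largest multioperations. -/
def fullSwap (A : Type a) [BooleanAlgebra A] : SwapStructure A where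
  carrier := {x | x.1 ⊔ x.2.1 = ⊤ ∧ x.1 ⊓ x.2.1 ⊓ x.2.2 = ⊥}
  carrier_nonempty := ⟨(⊤, ⊤, ⊥), by simp⟩
  sup_eq_top _ h := h.1
  inf_eq_bot _ h := h.2
  un c x := {z | z.1.1 = c.proj x.1}
  bin c x y := {z | z.1.1 = c.op x.1.1 y.1.1}
  -- Any `p` is the first coordinate of a snapshot, namely `(p, pᶜ, ⊥)`.
  un_nonempty c x := ⟨⟨(c.proj x.1, (c.proj x.1)ᶜ, ⊥), by simp⟩, rfl⟩
  bin_nonempty c x y := ⟨⟨(c.op x.1.1 y.1.1, (c.op x.1.1 y.1.1)ᶜ, ⊥), by simp⟩, rfl⟩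
  un_fst _ _ _ h := h
  bin_fst _ _ _ _ h := h

/-! ### Snapshots, and closed terms modulo provable equality -/

section
variable {Θ : Signature.{u, v}} {e : Θ.Pred} {he : Θ.predArity e = 2} {Γ : Set (Formula Θ)}
  {χ : Formula Θ} {Δ : Set (Formula Θ)}

/-- The snapshot of a formula with respect to a Henkin theory. -/
def IsHenkinTheory.snapshot (h : IsHenkinTheory e he Γ χ Δ) (φ : Formula Θ) :
    (fullSwap (Set PUnit.{a + 1})).carrier :=
  ⟨(truth (φ ∈ Δ), truth (φ.neg ∈ Δ), truth (φ.circ ∈ Δ)), by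
    constructor
    · exact Set.eq_univ_of_forall fun _ => h.mem_or_neg_mem φ
    · exact Set.eq_empty_of_forall_notMem fun _ hx => h.not_consistent hx.1.1 hx.1.2 hx.2⟩

theorem IsHenkinTheory.snapshot_congr (h : IsHenkinTheory e he Γ χ Δ) {φ ψ : Formula Θ}
    (h1 : φ ∈ Δ ↔ ψ ∈ Δ) (h2 : ∀ c, Formula.un c φ ∈ Δ ↔ Formula.un c ψ ∈ Δ) :
    h.snapshot.{u, v, a} φ = h.snapshot ψ := by
  refine Subtype.ext (Prod.ext ?_ (Prod.ext ?_ ?_))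
  · exact congrArg truth (propext h1)
  · exact congrArg truth (propext (h2 .neg))
  · exact congrArg truth (propext (h2 .circ))

theorem IsHenkinTheory.snapshot_mem (h : IsHenkinTheory e he Γ χ Δ) {φ : Formula Θ} :
    h.snapshot.{u, v, a} φ ∈ (fullSwap (Set PUnit.{a + 1})).D ↔ φ ∈ Δ := truth_eq_top

/-- All three coordinates are memberships in `Δ`, of instances of `φ`, `¬φ` and `∘φ`, so congruence
of equality applies to each. -/
theorem IsHenkinTheory.snapshot_subst (h : IsHenkinTheory e he Γ χ Δ) {σ τ : ℕ → Term Θ}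
    (hσ : ∀ x, (σ x).vars = ∅) (hτ : ∀ x, (τ x).vars = ∅)
    (heq : ∀ x, Formula.binAtom e he (σ x) (τ x) ∈ Δ) (φ : Formula Θ) :
    h.snapshot.{u, v, a} (φ.subst σ) = h.snapshot (φ.subst τ) := by
  have key : ∀ ψ : Formula Θ, ψ.subst σ ∈ Δ ↔ ψ.subst τ ∈ Δ := fun ψ =>
    ⟨h.eq_subst hσ hτ heq, h.eq_subst hτ hσ fun x => h.eq_symm (hσ x) (hτ x) (heq x)⟩
  exact h.snapshot_congr (key φ) fun c => key (.un c φ)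

theorem IsHenkinTheory.snapshot_atom (h : IsHenkinTheory e he Γ χ Δ) (p : Θ.Pred)
    {ss ts : Fin (Θ.predArity p) → Term Θ}
    (hs : ∀ i, (ss i).vars = ∅) (ht : ∀ i, (ts i).vars = ∅)
    (heq : ∀ i, Formula.binAtom e he (ss i) (ts i) ∈ Δ) :
    h.snapshot.{u, v, a} (.atom p ss) = h.snapshot (.atom p ts) := by
  have key := h.snapshot_subst (σ := assign (Θ.predArity_pos p) ss)
    (τ := assign (Θ.predArity_pos p) ts)
    (fun x => by unfold assign; split_ifs <;> exact hs _)
    (fun x => by unfold assign; split_ifs <;> exact ht _)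
    (fun x => by unfold assign; split_ifs <;> exact heq _) (.atom p fun i => .var i)
  simpa [Formula.subst, Term.subst] using key

/-- A domain whose elements represent the closed terms up to provable equality. -/
structure TermDomain {Θ : Signature.{u, v}} (e : Θ.Pred) (he : Θ.predArity e = 2)
    (Δ : Set (Formula Θ)) (U : Type w) where
  rep : U → Term Θ
  rep_closed : ∀ b, (rep b).vars = ∅
  cls : {t : Term Θ // t.vars = ∅} → U
  rep_cls : ∀ t, Formula.binAtom e he (rep (cls t)) t ∈ Δ
  eq_of_mem : ∀ b c, Formula.binAtom e he (rep b) (rep c) ∈ Δ → b = c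

/-- The domain is the quotient by equality in `Δ`. With chosen representatives, the canonical
interpretations need no proof of independence of representatives. -/
theorem IsHenkinTheory.exists_termDomain (h : IsHenkinTheory e he Γ χ Δ) (t : Term Θ)
    (ht : t.vars = ∅) :
    ∃ U : Type max u v w, Nonempty U ∧ Nonempty (TermDomain e he Δ U) := by
  let s : Setoid (ULift.{w} {t : Term Θ // t.vars = ∅}) :=
    { r := fun a b => Formula.binAtom e he a.down b.down ∈ Δ
      iseqv := ⟨fun a => h.eq_refl a.down.2, fun {a b} => h.eq_symm a.down.2 b.down.2,
        fun {a b c} => h.eq_trans a.down.2 b.down.2 c.down.2⟩ }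
  refine ⟨Quotient s, ⟨⟦⟨t, ht⟩⟧⟩, ⟨{
    rep := fun b => b.out.down
    rep_closed := fun b => b.out.down.2
    cls := fun t => ⟦⟨t⟩⟧
    rep_cls := fun t => Quotient.exact (Quotient.out_eq (⟦⟨t⟩⟧ : Quotient s))
    eq_of_mem := fun b c hbc => ?_ }⟩⟩
  rw [← Quotient.out_eq b, ← Quotient.out_eq c]
  exact Quotient.sound hbc

end

/-! ### The canonical structure and valuation -/

section
variable {Θ : Signature.{u, v}} {H : Type w} {e : Θ.Pred} {he : Θ.predArity e = 2}
  {Γ : Set (Formula (Θ.diagram H))} {χ : Formula (Θ.diagram H)} {Δ : Set (Formula (Θ.diagram H))}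
  {U : Type*}

namespace TermDomain

/-- The interpretation of the constants of the diagram language by terms. -/
def constMap (M : TermDomain (Θ := Θ.diagram H) e he Δ U) :
    Θ.Const ⊕ U → Term (Θ.setConst (Θ.Const ⊕ H)) :=
  Sum.elim (fun c => .const (.inl c)) M.rep

theorem constMap_closed (M : TermDomain (Θ := Θ.diagram H) e he Δ U) (c : Θ.Const ⊕ U) :
    (M.constMap c).vars = ∅ := by
  rcases c with c | c
  · rfl
  · exact M.rep_closed c

/-- The translation of terms of the diagram language, in which `b̄` becomes a representative of
`b`. -/
def trT (M : TermDomain (Θ := Θ.diagram H) e he Δ U) (t : Term (Θ.diagram U)) :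
    Term (Θ.diagram H) := Term.kmap (Θ := Θ) M.constMap t

/-- The translation of formulas of the diagram language, in which `b̄` becomes a representative of
`b`. -/
def tr (M : TermDomain (Θ := Θ.diagram H) e he Δ U) (φ : Formula (Θ.diagram U)) :
    Formula (Θ.diagram H) := Formula.kmap (Θ := Θ) M.constMap φ

theorem tr_close (M : TermDomain (Θ := Θ.diagram H) e he Δ U) (φ : Formula (Θ.diagram U))
    (μ : ℕ → U) : M.tr (φ.close μ) = (M.tr φ).subst fun x => M.rep (μ x) :=
  Formula.kmap_subst (Θ := Θ) fun c y hy => by simp [M.constMap_closed] at hy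

theorem tr_substVar (M : TermDomain (Θ := Θ.diagram H) e he Δ U) (φ : Formula (Θ.diagram U))
    (x : ℕ) (t : Term (Θ.diagram U)) : M.tr (φ.substVar x t) = (M.tr φ).substVar x (M.trT t) :=
  Formula.kmap_substVar (Θ := Θ) (avoids_of_closed M.constMap_closed _)

theorem tr_freeFor (M : TermDomain (Θ := Θ.diagram H) e he Δ U) {φ : Formula (Θ.diagram U)}
    {x : ℕ} {t : Term (Θ.diagram U)} (h : Formula.FreeFor t x φ) :
    Formula.FreeFor (M.trT t) x (M.tr φ) :=
  Formula.FreeFor.kmap (Θ := Θ) (avoids_of_closed M.constMap_closed _) h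

theorem trT_closed (M : TermDomain (Θ := Θ.diagram H) e he Δ U) {t : Term (Θ.diagram U)}
    (ht : t.vars = ∅) : (M.trT t).vars = ∅ := by
  rw [Finset.eq_empty_iff_forall_notMem]
  intro y hy
  rcases Term.mem_vars_kmap (Θ := Θ) hy with h | ⟨c, h⟩
  · simp [ht] at h
  · simp [M.constMap_closed] at h

theorem tr_lift (M : TermDomain (Θ := Θ.diagram H) e he Δ U) (φ : Formula Θ) :
    M.tr (φ.lift U) = φ.lift H :=
  (Formula.kmap_lift M.constMap φ).trans φ.lift_eq_kmap.symm

variable (M : TermDomain (Θ := Θ.diagram H) e he Δ U)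
  (h : IsHenkinTheory (Θ := Θ.diagram H) e he Γ χ Δ)

/-- The canonical structure. -/
def struc : Struc Θ U (fullSwap (Set PUnit.{a + 1})) where
  const c := M.cls ⟨.const (.inl c), rfl⟩
  func f bs := M.cls ⟨.func (Θ := Θ.diagram H) f fun i => M.rep (bs i),
    Term.vars_func_of_closed fun i => M.rep_closed (bs i)⟩
  pred p bs := h.snapshot (.atom (Θ := Θ.diagram H) p fun i => M.rep (bs i))

theorem rep_eval (μ : ℕ → U) (t : Term (Θ.diagram U)) :
    Formula.binAtom (Θ := Θ.diagram H) e he (M.rep ((M.struc.{u, v, w, a} h).expand.eval μ t))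
      ((M.trT t).subst fun x => M.rep (μ x)) ∈ Δ := by
  induction t with
  | var x => exact h.eq_refl (M.rep_closed (μ x))
  | const c =>
    rcases c with c | c
    · exact M.rep_cls ⟨.const (.inl c), rfl⟩
    · have e : (M.trT (.const (.inr c))).subst (fun x => M.rep (μ x)) = M.rep c :=
        Term.subst_of_closed (M.rep_closed c) _
      rw [e]
      exact h.eq_refl (M.rep_closed c)
  | func f ts ih =>
    have hc : ∀ t : Term (Θ.diagram U), ((M.trT t).subst fun x => M.rep (μ x)).vars = ∅ :=
      fun t => Term.vars_subst_of_closed (fun x => M.rep_closed (μ x)) _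
    exact h.eq_trans (M.rep_closed _) (Term.vars_func_of_closed fun i => M.rep_closed _)
      (hc (.func f ts)) (M.rep_cls ⟨_, _⟩)
      (h.eq_func f (fun i => M.rep_closed _) (fun i => hc (ts i)) ih)

/-- The canonical valuation. -/
def val (φ : Formula (Θ.diagram U)) : (fullSwap (Set PUnit.{a + 1})).carrier :=
  h.snapshot (M.tr φ)

/-- The equality of clause (vi), obtained outright: by `rep_eval`, both sides are snapshots of one
formula under closed substitutions that are equal in `Δ`. -/
theorem val_substVar {φ : Formula (Θ.diagram U)} {z : ℕ} {t : Term (Θ.diagram U)}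
    (hf : Formula.FreeFor t z φ) (μ : ℕ → U) :
    M.val.{u, v, w, a} h ((φ.substVar z t).close μ) =
      M.val h ((φ.substVar z (name ((M.struc.{u, v, w, a} h).expand.eval μ t))).close μ) := by
  have hname : ∀ b : U, M.trT (name b) = M.rep b := fun _ => rfl
  unfold val
  rw [tr_close, tr_close, tr_substVar, tr_substVar, Formula.substVar_subst (M.tr_freeFor hf),
    hname, Formula.substVar_subst (Formula.freeFor_of_closed (M.rep_closed _) _ _),
    Term.subst_of_closed (M.rep_closed _)]
  have hc := Term.vars_subst_of_closed (fun x => M.rep_closed (μ x)) (M.trT t)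
  refine h.snapshot_subst (fun x => ?_) (fun x => ?_) (fun x => ?_) _
  all_goals by_cases hx : x = z
  all_goals simp only [hx, Function.update_self, ne_eq, not_false_eq_true, Function.update_of_ne,
    M.rep_closed, hc]
  · exact h.eq_symm (M.rep_closed _) hc (M.rep_eval h μ t)
  · exact h.eq_refl (M.rep_closed _)

include h in
-- This turns quantification over closed terms, as in a Henkin theory, into quantification over the
-- domain.
theorem quant_mem {φ : Formula (Θ.diagram H)} {x : ℕ} (hx : ∀ y ∈ φ.fv, y = x)
    {t : Term (Θ.diagram H)} (ht : t.vars = ∅) :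
    φ.substVar x t ∈ Δ ↔ φ.substVar x (M.rep (M.cls ⟨t, ht⟩)) ∈ Δ := by
  have key : ∀ s : Term (Θ.diagram H), φ.substVar x s = φ.subst fun _ => s := fun s =>
    Formula.subst_congr fun y hy => by simp [hx y hy]
  have h1 := M.rep_cls ⟨t, ht⟩
  rw [key, key]
  exact ⟨h.eq_subst (fun _ => ht) (fun _ => M.rep_closed _)
      fun _ => h.eq_symm (M.rep_closed _) ht h1,
    h.eq_subst (fun _ => M.rep_closed _) (fun _ => ht) fun _ => h1⟩

include h in
theorem all_mem {φ : Formula (Θ.diagram H)} {x : ℕ} (hx : ∀ y ∈ φ.fv, y = x) :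
    Formula.all x φ ∈ Δ ↔ ∀ b, φ.substVar x (M.rep b) ∈ Δ :=
  h.all_mem.trans ⟨fun hall b => hall _ (M.rep_closed b),
    fun hall _ ht => (M.quant_mem h hx ht).2 (hall _)⟩

include h in
theorem ex_mem (hχ : χ.IsSentence) {φ : Formula (Θ.diagram H)} {x : ℕ} (hx : ∀ y ∈ φ.fv, y = x) :
    Formula.ex x φ ∈ Δ ↔ ∃ b, φ.substVar x (M.rep b) ∈ Δ :=
  (h.ex_mem hχ).trans ⟨fun ⟨_, ht, hφ⟩ => ⟨_, (M.quant_mem h hx ht).1 hφ⟩,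
    fun ⟨b, hφ⟩ => ⟨_, M.rep_closed b, hφ⟩⟩

theorem isValuation (hχ : χ.IsSentence) : IsValuation (M.struc.{u, v, w, a} h) (M.val h) where
  atom p ts hs μ := by
    have hts : ∀ i, (ts i).vars = ∅ := by
      intro i
      rw [Formula.IsSentence, Finset.eq_empty_iff_forall_notMem] at hs
      rw [Finset.eq_empty_iff_forall_notMem]
      exact fun y hy => hs y (Formula.mem_fv_atom.2 ⟨i, hy⟩)
    refine h.snapshot_atom p (ss := fun i => M.trT (ts i)) (fun i => M.trT_closed (hts i))
      (fun i => M.rep_closed _) fun i => ?_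
    have := M.rep_eval h μ (ts i)
    rw [Term.subst_of_closed (M.trT_closed (hts i))] at this
    exact h.eq_symm (M.rep_closed _) (M.trT_closed (hts i)) this
  -- The second and third coordinates of a snapshot record `¬φ ∈ Δ` and `∘φ ∈ Δ`, which are the
  -- first coordinates of the snapshots of `¬φ` and `∘φ`.
  un c φ _ := by cases c <;> rfl
  bin c φ ψ _ _ := by
    cases c
    · exact Set.ext fun _ => h.and_mem
    · exact Set.ext fun _ => h.or_mem
    · refine Set.ext fun _ => h.imp_mem_iff.trans ?_
      simp only [BinConn.op, himp_eq]
      exact imp_iff_or_not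
  quant q x φ hs := by
    have hx : ∀ y ∈ (M.tr φ).fv, y = x := by
      intro y hy
      by_contra hyx
      have := Formula.isSentence_kmap (Θ := Θ) M.constMap_closed hs
      rw [Formula.IsSentence, Finset.eq_empty_iff_forall_notMem] at this
      exact this y (Finset.mem_erase.2 ⟨hyx, hy⟩)
    have e : ∀ b : U, M.tr (φ.substVar x (name b)) = (M.tr φ).substVar x (M.rep b) :=
      fun b => M.tr_substVar φ x _
    unfold val
    simp only [e]
    cases q
    · refine Set.ext fun _ => (M.all_mem h hx).trans ?_
      simp only [Quant.op, Set.iInf_eq_iInter, Set.mem_iInter]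
      exact Iff.rfl
    · refine Set.ext fun _ => (M.ex_mem h hχ hx).trans ?_
      simp only [Quant.op, Set.iSup_eq_iUnion, Set.mem_iUnion]
      exact Iff.rfl
  subst_un c φ z t hf μ _ := M.val_substVar h (φ := .un c φ) hf μ
  subst_bin c φ ψ z t h1 h2 μ _ _ := M.val_substVar h (φ := .bin c φ ψ) ⟨h1, h2⟩ μ
  subst_quant q φ z t hf μ x hxz hx _ := M.val_substVar h (φ := .quant q x φ) (.inr ⟨hx, hf⟩) μ
  variant φ ψ _ _ hv := by
    obtain ⟨F, hF⟩ := Formula.Variant.kmap (Θ := Θ) (C' := Θ.Const ⊕ H) hv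
    have hv' : Formula.Variant (M.tr φ) (M.tr ψ) := hF _ (avoids_of_closed M.constMap_closed _)
    exact h.snapshot_congr (h.variant_mem hv') fun c => h.variant_mem (hv'.un c)

theorem val_close_mem {φ : Formula (Θ.diagram U)} {μ : ℕ → U} :
    M.val.{u, v, w, a} h (φ.close μ) ∈ (fullSwap (Set PUnit.{a + 1})).D ↔
      ((M.tr φ).subst fun x => M.rep (μ x)) ∈ Δ := by
  rw [← tr_close]
  exact h.snapshot_mem

theorem val_lift_mem {φ : Formula Θ} {μ : ℕ → U} :
    M.val.{u, v, w, a} h ((φ.lift U).close μ) ∈ (fullSwap (Set PUnit.{a + 1})).D ↔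
      ((φ.lift H).subst fun x => M.rep (μ x)) ∈ Δ := by
  rw [val_close_mem, tr_lift]

theorem val_axEq2 {φ : Formula (Θ.diagram U)} (hφ : AxEq2 (Θ := Θ.diagram U) e he φ) (μ : ℕ → U) :
    M.val.{u, v, w, a} h (φ.close μ) ∈ (fullSwap (Set PUnit.{a + 1})).D := by
  obtain ⟨F, hF⟩ := AxEq2.kmap (Θ := Θ) (C' := Θ.Const ⊕ H) hφ
  exact (M.val_close_mem h).2 (h.subst_mem
    (.ax (.axEq2 (hF _ (avoids_of_closed M.constMap_closed _)))) fun x => M.rep_closed (μ x))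

end TermDomain
end

section
variable {Θ : Signature.{u, v}} {H : Type w} {Γ : Set (Formula (Θ.withEq.diagram H))}
  {χ : Formula (Θ.withEq.diagram H)} {Δ : Set (Formula (Θ.withEq.diagram H))} {U : Type*}
  (M : TermDomain (Θ := Θ.withEq.diagram H) none rfl Δ U)
  (h : IsHenkinTheory (Θ := Θ.withEq.diagram H) none rfl Γ χ Δ)

theorem TermDomain.hasStandardEq : HasStandardEq (TermDomain.struc.{u, v, w, a} M h) := by
  intro b c
  refine h.snapshot_mem.trans ?_
  have e : Formula.atom (Θ := Θ.withEq.diagram H) none (fun i => M.rep (![b, c] i)) =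
      Formula.binAtom (Θ := Θ.withEq.diagram H) none rfl (M.rep b) (M.rep c) := by
    refine congrArg (Formula.atom (Θ := Θ.withEq.diagram H) none) (funext fun i => ?_)
    change M.rep (![b, c] i) = ![M.rep b, M.rep c] i
    fin_cases i <;> rfl
  rw [e]
  refine ⟨M.eq_of_mem b c, ?_⟩
  rintro rfl
  exact h.eq_refl (M.rep_closed b)

theorem TermDomain.isValuationEq (hχ : χ.IsSentence) :
    IsValuationEq (TermDomain.struc.{u, v, w, a} M h) (M.val h) where
  toIsValuation := M.isValuation h hχ
  axEq2 _ μ hφ := val_axEq2 (Θ := Θ.withEq) (e := none) (he := rfl) M h hφ μ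

end

/-! ### Completeness -/

theorem Formula.IsSentence.lift {Θ : Signature.{u, v}} {U : Type w} {φ : Formula Θ}
    (h : φ.IsSentence) : (φ.lift U).IsSentence := by
  rw [IsSentence, Finset.eq_empty_iff_forall_notMem] at h ⊢
  exact fun y => notMem_fv_lift (h y)

theorem EntailsEq.derivesEq_of_isSentence {Θ : Signature.{u, v}} {Γ : Set (Formula Θ.withEq)}
    {φ : Formula Θ.withEq} (hφ : φ.IsSentence) (h : EntailsEq.{u, v, max u v w, a} Γ φ) :
    DerivesEq Γ φ := by
  rw [derivesEq_iff]
  by_contra hn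
  obtain ⟨Δ, hΔ⟩ := exists_isHenkinTheory hn
  -- Any Henkin constant serves as the closed term that makes the domain nonempty, even if `Θ` has
  -- no constants.
  obtain ⟨U, hU, ⟨M⟩⟩ := hΔ.exists_termDomain.{max u v, v, w} (name (.var 0)) rfl
  have hv := h (Set PUnit.{a + 1}) (fullSwap _) U (M.struc hΔ) (M.hasStandardEq hΔ) (M.val hΔ)
    (M.isValuationEq hΔ hφ.lift) (fun γ hγ μ =>
      (TermDomain.val_lift_mem (Θ := Θ.withEq) (e := none) (he := rfl) M hΔ).2
        (hΔ.subst_mem (.hyp ⟨γ, hγ, rfl⟩) fun x => M.rep_closed (μ x))) fun _ => hU.some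
  have hv' := (TermDomain.val_lift_mem (Θ := Θ.withEq) (e := none) (he := rfl) M hΔ).1 hv
  rw [hφ.lift.subst_eq] at hv'
  exact hΔ.notMem hv'

/-- Both consequence relations are closed under generalization, and (Ax13) undoes it, so the free
variables can be quantified away one by one. -/
theorem EntailsEq.derivesEq {Θ : Signature.{u, v}} {Γ : Set (Formula Θ.withEq)}
    {φ : Formula Θ.withEq} (h : EntailsEq.{u, v, max u v w, a} Γ φ) : DerivesEq Γ φ := by
  induction hn : φ.fv.card generalizing φ with
  | zero => exact EntailsEq.derivesEq_of_isSentence (Finset.card_eq_zero.1 hn) h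
  | succ n ih =>
    obtain ⟨x, hx⟩ := Finset.card_pos.1 (by rw [hn]; exact Nat.succ_pos n)
    have hd := ih (h.all x) (by
      change (φ.fv.erase x).card = n
      rw [Finset.card_erase_of_mem hx, hn, Nat.add_sub_cancel])
    rw [derivesEq_iff] at hd ⊢
    exact hd.of_all

end QmbC

/-- In the second half the universe of domains has to hold the quotient of closed terms, hence `max
u v w`; the universe of algebras is arbitrary, as two truth values suffice. -/
theorem mainTheorem5 (Θ : QmbC.Signature.{u, v}) (Γ : Set (QmbC.Formula Θ.withEq))
    (φ : QmbC.Formula Θ.withEq) :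
    (QmbC.DerivesEq Γ φ → QmbC.EntailsEq.{u, v, w, a} Γ φ) ∧
      (QmbC.EntailsEq.{u, v, max u v w, a} Γ φ → QmbC.DerivesEq Γ φ) :=
  ⟨QmbC.EntailsEq.of_derivesEq, QmbC.EntailsEq.derivesEq⟩
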